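/- Let $d \ge 1$ be an integer. Let $\mathbb B_d$ be the open Euclidean unit ball of $\mathbb C^d$ and $\mathbb D$ the open unit disc of $\mathbb C$, and let $\tau : \mathbb B_d \to \mathbb D$, $\tau(z) = d^{d/2} z_1 z_2 \cdots z_d$. For $s \in \mathbb R$ let $\mathcal H_s(\mathbb B_d)$ be the reproducing kernel Hilbert space on $\mathbb B_d$ with kernel $\sum_{n=0}^\infty (n+1)^s \langle z, w\rangle^n$. For $a > 0$ let $\mathcal D_a(\mathbb B_d)$ be the reproducing kernel Hilbert space on $\mathbb B_d$ with kernel $(1 - \langle z, w\rangle)^{-a}$, and let $\mathcal D_0(\mathbb B_d)$ be the one with kernel $\frac{1}{\langle z,w\rangle} \log\big(\frac{1}{1-\langle z,w\rangle}\big)$ (equal to $1$ where $\langle z,w\rangle = 0$). Write $\mathcal H_s = \mathcal H_s(\mathbb D)$ and $\mathcal D_a = \mathcal D_a(\mathbb D)$ for the spaces on $\mathbb D$ with the same kernels, where $\langle z,w\rangle = z\overline w$. For a reproducing kernel Hilbert space $\mathcal H$ of functions $X \to \mathbb C$, $\operatorname{Mult}(\mathcal H)$ is the algebra of all $\varphi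 : X \to \mathbb C$ with $\varphi f \in \mathcal H$ for every $f \in \mathcal H$; identifying $\varphi$ with the bounded operator $M_\varphi f = \varphi f$ on $\mathcal H$, the matrices $M_n(\operatorname{Mult}(\mathcal H))$ carry the operator norm on $\mathcal H^n$. A linear map between such algebras, or subspaces of them, is completely bounded if its entrywise extensions to $n \times n$ matrices are bounded with a bound independent of $n$; an algebra homomorphism is a completely bounded isomorphism onto its image if it is injective, it is completely bounded, and its inverse, defined on its image, is completely bounded. **Proposition.** For every $s \in \mathbb R$, the map $$\operatorname{Mult}(\mathcal H_{s - (d-1)/2}) \to \operatorname{Mult}(\mathcal H_s(\mathbb B_d)), \quad \varphi \mapsto \varphi \circ \tau,$$ is well defined and is a completely bounded isomorphism onto its image. In particular, for every real $a \ge \frac{d-1}{2}$, the map $$\operatorname{Mult}(\mathcal D_{a - (d-1)/2}) \to \operatorname{Mult}(\mathcal D_a(\mathbb B_d)), \quad \varphi \mapsto \varphi \circ \tau,$$ is well defined and is a completely bounded isomorphism onto its image. -/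

import Mathlib

open scoped NNReal ComplexOrder

noncomputable section

/-! ### Kernels on the open unit ball of a complex inner product space -/

section Kernels

variable (E : Type*) [NormedAddCommGroup E] [InnerProductSpace ℂ E]

/-- The open unit ball of `E`: the unit disc `𝔻` for `E = ℂ` and the Euclidean unit ball `𝔹_d` for
`E = EuclideanSpace ℂ (Fin d)`. -/
abbrev OpenUnitBall : Type _ := Metric.ball (0 : E) 1

variable {E}

/-- The pairing `⟨z, w⟩`, linear in `z` and conjugate linear in `w`. -/
def pairing (z w : OpenUnitBall E) : ℂ := inner ℂ (w : E) (z : E)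

theorem norm_pairing_lt_one (z w : OpenUnitBall E) : ‖pairing z w‖ < 1 := by
  have hz : ‖(z : E)‖ < 1 := mem_ball_zero_iff.mp z.2
  have hw : ‖(w : E)‖ < 1 := mem_ball_zero_iff.mp w.2
  calc ‖pairing z w‖ ≤ ‖(w : E)‖ * ‖(z : E)‖ := norm_inner_le_norm _ _
    _ < 1 := by nlinarith [norm_nonneg (z : E), norm_nonneg (w : E)]

variable (E)

/-- The kernel `(z, w) ↦ g ⟨z, w⟩` on the unit ball, with the complex number `g ⟨z, w⟩` regarded as
the operator of multiplication by it on `ℂ`. -/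
def ballKernel (g : ℂ → ℂ) : Matrix (OpenUnitBall E) (OpenUnitBall E) (ℂ →L[ℂ] ℂ) :=
  Matrix.of fun z w => g (pairing z w) • ContinuousLinearMap.id ℂ ℂ

variable {E}

theorem posSemidef_pairing :
    (Matrix.of fun z w : OpenUnitBall E => pairing z w).PosSemidef := by
  refine ⟨Matrix.ext fun z w => inner_conj_symm _ _, fun x => ?_⟩
  have h : (x.sum fun i xi => x.sum fun j xj => star xi *
      (Matrix.of fun z w : OpenUnitBall E => pairing z w) i j * xj) =
      inner ℂ (x.sum fun i xi => star xi • (i : E)) (x.sum fun i xi => star xi • (i : E)) := by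
    simp only [Finsupp.sum, sum_inner, inner_sum, inner_smul_left, inner_smul_right, pairing,
      Matrix.of_apply, Finset.mul_sum]
    refine Finset.sum_congr rfl fun i _ => Finset.sum_congr rfl fun j _ => ?_
    simp
    ring
  rw [h, inner_self_eq_norm_sq_to_K]
  exact pow_nonneg (Complex.zero_le_real.mpr
    (norm_nonneg (x.sum fun i xi => star xi • (i : E)))) 2

theorem posSemidef_pairing_pow (n : ℕ) :
    (Matrix.of fun z w : OpenUnitBall E => pairing z w ^ n).PosSemidef := by
  induction n with
  | zero =>
    refine ⟨Matrix.ext fun z w => by simp, fun x => ?_⟩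
    have h : (x.sum fun i xi => x.sum fun j xj => star xi *
        (Matrix.of fun z w : OpenUnitBall E => pairing z w ^ 0) i j * xj) =
        star (x.sum fun _ xi => xi) * (x.sum fun _ xi => xi) := by
      simp only [Finsupp.sum, star_sum, Finset.sum_mul_sum, Matrix.of_apply, pow_zero, mul_one]
    rw [h]
    exact star_mul_self_nonneg _
  | succ n ih =>
    have h := ih.hadamard posSemidef_pairing
    have e : (Matrix.of fun z w : OpenUnitBall E => pairing z w ^ (n + 1)) =
        (Matrix.of fun z w : OpenUnitBall E => pairing z w ^ n).hadamard
          (Matrix.of fun z w : OpenUnitBall E => pairing z w) := by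
      ext z w
      simp [Matrix.hadamard, pow_succ]
    rw [e]
    exact h

theorem posSemidef_scalar_ballKernel {g : ℂ → ℂ} {c : ℕ → ℝ} (hc : ∀ n, 0 ≤ c n)
    (hg : ∀ x : ℂ, ‖x‖ < 1 → HasSum (fun n => (c n : ℂ) * x ^ n) (g x)) :
    (Matrix.of fun z w : OpenUnitBall E => g (pairing z w)).PosSemidef := by
  have key : ∀ x : OpenUnitBall E →₀ ℂ, HasSum
      (fun n => (c n : ℂ) * x.sum fun i xi => x.sum fun j xj =>
        star xi * (Matrix.of fun z w : OpenUnitBall E => pairing z w ^ n) i j * xj)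
      (x.sum fun i xi => x.sum fun j xj =>
        star xi * (Matrix.of fun z w : OpenUnitBall E => g (pairing z w)) i j * xj) := by
    intro x
    simp only [Finsupp.sum, Finset.mul_sum, Matrix.of_apply]
    refine hasSum_sum fun i _ => hasSum_sum fun j _ => ?_
    have h := ((hg _ (norm_pairing_lt_one i j)).mul_left (star (x i))).mul_right (x j)
    refine h.congr_fun fun n => ?_
    ring
  refine ⟨Matrix.ext fun z w => ?_, fun x => ?_⟩
  · have h1 := (hg _ (norm_pairing_lt_one w z)).star
    refine h1.unique ?_
    refine (hg _ (norm_pairing_lt_one z w)).congr_fun fun n => ?_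
    have : star (pairing w z) = pairing z w := inner_conj_symm _ _
    rw [star_mul', star_pow, this]
    simp
  · exact (key x).nonneg fun n =>
      mul_nonneg (by exact_mod_cast hc n) ((posSemidef_pairing_pow n).2 x)

/-- A kernel given by a power series in `⟨z, w⟩` with nonnegative coefficients is positive
semidefinite. -/
theorem posSemidef_ballKernel {g : ℂ → ℂ} {c : ℕ → ℝ} (hc : ∀ n, 0 ≤ c n)
    (hg : ∀ x : ℂ, ‖x‖ < 1 → HasSum (fun n => (c n : ℂ) * x ^ n) (g x)) :
    (ballKernel E g).PosSemidef := by
  have hS := posSemidef_scalar_ballKernel (E := E) hc hg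
  have T := RKHS.posSemidef_tfae (K := ballKernel E g)
  refine (T.out 0 2 rfl rfl).mpr (And.intro (Matrix.ext fun z w => ?_) fun x => ?_)
  · have h : star (g (pairing w z)) = g (pairing z w) := hS.1.apply z w
    rw [Matrix.conjTranspose_apply, ballKernel, Matrix.of_apply, Matrix.of_apply, star_smul, h]
    congr 1
    exact star_one (ℂ →L[ℂ] ℂ)
  · have h := (Complex.le_def.mp (hS.2 x)).1
    convert! h using 2
    refine Finsupp.sum_congr fun z _ => Finsupp.sum_congr fun w _ => ?_
    have h : star (g (pairing w z)) = g (pairing z w) := hS.1.apply z w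
    simp [ballKernel, ← h]
    ring

end Kernels

/-! ### The two scales of spaces -/

section Spaces

variable (E : Type*) [NormedAddCommGroup E] [InnerProductSpace ℂ E]

/-- The function `x ↦ ∑ n, (n + 1) ^ s * x ^ n`. -/
def besovFun (s : ℝ) (x : ℂ) : ℂ := ∑' n : ℕ, (((n + 1 : ℝ) ^ s : ℝ) : ℂ) * x ^ n

/-- The function `x ↦ 1 / (1 - x) ^ a` for `a > 0`, and `x ↦ (1 / x) * log (1 / (1 - x))`, with its
removable singularity at `0` filled in, for `a = 0`. -/
def dirichletFun (a : ℝ≥0) (x : ℂ) : ℂ :=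
  if a = 0 then (if x = 0 then 1 else 1 / x * Complex.log (1 / (1 - x)))
  else 1 / (1 - x) ^ ((a : ℝ) : ℂ)

theorem hasSum_besovFun (s : ℝ) (x : ℂ) (hx : ‖x‖ < 1) :
    HasSum (fun n : ℕ => (((n + 1 : ℝ) ^ s : ℝ) : ℂ) * x ^ n) (besovFun s x) := by
  refine Summable.hasSum ?_
  obtain ⟨k, hk⟩ := exists_nat_ge s
  have h1 : Summable fun n : ℕ => (((n + 1 : ℕ) : ℝ) ^ k) * ‖x‖ ^ n := by
    rcases eq_or_ne x 0 with rfl | h0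
    · refine summable_of_ne_finset_zero (s := {0}) fun n hn => ?_
      have : n ≠ 0 := by simpa using hn
      simp [this]
    · have h := (summable_pow_mul_geometric_of_norm_lt_one k
        (r := ‖x‖) (by simpa using hx))
      have h2 := ((summable_nat_add_iff 1).mpr h).mul_right ‖x‖⁻¹
      refine h2.congr fun n => ?_
      have : ‖x‖ ≠ 0 := norm_ne_zero_iff.mpr h0
      field_simp
      ring
  refine Summable.of_norm_bounded h1 fun n => ?_
  have hn : (1 : ℝ) ≤ n + 1 := by linarith [Nat.cast_nonneg (α := ℝ) n]
  rw [norm_mul, norm_pow, Complex.norm_real, Real.norm_of_nonneg (by positivity)]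
  gcongr
  push_cast
  rw [← Real.rpow_natCast]
  exact Real.rpow_le_rpow_of_exponent_le hn hk

theorem exists_hasSum_dirichletFun (a : ℝ≥0) : ∃ c : ℕ → ℝ, (∀ n, 0 ≤ c n) ∧
    ∀ x : ℂ, ‖x‖ < 1 → HasSum (fun n => (c n : ℂ) * x ^ n) (dirichletFun a x) := by
  rcases eq_or_ne a 0 with rfl | ha
  · refine ⟨fun n => 1 / ((n : ℝ) + 1), fun n => by positivity, fun x hx => ?_⟩
    rcases eq_or_ne x 0 with rfl | h0
    · have h := hasSum_ite_eq (0 : ℕ) (1 : ℂ)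
      simp only [dirichletFun, if_true]
      refine h.congr_fun fun n => ?_
      rcases eq_or_ne n 0 with rfl | hn
      · simp
      · simp [hn]
    · have h := (Complex.hasSum_taylorSeries_neg_log' hx).mul_left (1 / x)
      have hl : Complex.log (1 / (1 - x)) = -Complex.log (1 - x) := by
        rw [one_div, Complex.log_inv]
        intro harg
        have hs := Complex.mem_slitPlane_of_norm_lt_one (z := -x) (by simpa using hx)
        rw [← sub_eq_add_neg] at hs
        exact (Complex.mem_slitPlane_iff_arg.mp hs).1 harg
      simp only [dirichletFun, if_true, if_neg h0, hl]
      refine h.congr_fun fun n => ?_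
      push_cast
      field_simp
      ring
  · refine ⟨fun n => Ring.multichoose (a : ℝ) n, fun n => ?_, fun x hx => ?_⟩
    · have h := Ring.factorial_nsmul_multichoose_eq_ascPochhammer (a : ℝ) n
      rw [Polynomial.ascPochhammer_smeval_eq_eval, nsmul_eq_mul] at h
      have h1 := ascPochhammer_pos n (a : ℝ) (by exact_mod_cast pos_iff_ne_zero.mpr ha)
      rw [← h] at h1
      exact (pos_of_mul_pos_right h1 (Nat.cast_nonneg _)).le
    · have h := (Complex.one_div_one_sub_cpow_hasFPowerSeriesOnBall_zero
        ((a : ℝ) : ℂ)).hasSum (y := x) (by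
          rw [← ENNReal.ofReal_one, Metric.eball_ofReal]
          exact mem_ball_zero_iff.mpr hx)
      simp only [dirichletFun, if_neg ha]
      rw [zero_add] at h
      refine h.congr_fun fun n => ?_
      have hm := Ring.map_multichoose Complex.ofRealHom (a : ℝ) n
      rw [Complex.ofRealHom_eq_coe, Complex.ofRealHom_eq_coe] at hm
      rw [hm]
      simp [FormalMultilinearSeries.ofScalars, Ring.multichoose_eq]

theorem posSemidef_besov (s : ℝ) : (ballKernel E (besovFun s)).PosSemidef :=
  posSemidef_ballKernel (c := fun n => (n + 1 : ℝ) ^ s) (fun n => by positivity)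
    (hasSum_besovFun s)

theorem posSemidef_dirichlet (a : ℝ≥0) : (ballKernel E (dirichletFun a)).PosSemidef := by
  obtain ⟨c, hc, h⟩ := exists_hasSum_dirichletFun a
  exact posSemidef_ballKernel hc h

instance fact_posSemidef_besov (s : ℝ) : Fact (ballKernel E (besovFun s)).PosSemidef :=
  ⟨posSemidef_besov E s⟩

instance fact_posSemidef_dirichlet (a : ℝ≥0) : Fact (ballKernel E (dirichletFun a)).PosSemidef :=
  ⟨posSemidef_dirichlet E a⟩

/-- The space `ℋ_s`: the reproducing kernel Hilbert space on the open unit ball of `E` with kernel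
`∑ n, (n + 1) ^ s ⟨z, w⟩ ^ n`. -/
def BesovSpace (s : ℝ) : Type _ := RKHS.OfKernel (ballKernel E (besovFun s))

/-- The weighted Dirichlet space `𝒟_a`, `a ≥ 0`: the reproducing kernel Hilbert space on the open
unit ball of `E` with kernel `1 / (1 - ⟨z, w⟩) ^ a` if `a > 0` and
`⟨z, w⟩⁻¹ log (1 / (1 - ⟨z, w⟩))` if `a = 0`. -/
def DirichletSpace (a : ℝ≥0) : Type _ := RKHS.OfKernel (ballKernel E (dirichletFun a))

instance (s : ℝ) : NormedAddCommGroup (BesovSpace E s) :=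
  inferInstanceAs (NormedAddCommGroup (RKHS.OfKernel (ballKernel E (besovFun s))))

instance (s : ℝ) : InnerProductSpace ℂ (BesovSpace E s) :=
  inferInstanceAs (InnerProductSpace ℂ (RKHS.OfKernel (ballKernel E (besovFun s))))

instance (s : ℝ) : CompleteSpace (BesovSpace E s) :=
  inferInstanceAs (CompleteSpace (RKHS.OfKernel (ballKernel E (besovFun s))))

instance (s : ℝ) : RKHS ℂ (BesovSpace E s) (OpenUnitBall E) ℂ :=
  inferInstanceAs (RKHS ℂ (RKHS.OfKernel (ballKernel E (besovFun s))) (OpenUnitBall E) ℂ)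

instance (a : ℝ≥0) : NormedAddCommGroup (DirichletSpace E a) :=
  inferInstanceAs (NormedAddCommGroup (RKHS.OfKernel (ballKernel E (dirichletFun a))))

instance (a : ℝ≥0) : InnerProductSpace ℂ (DirichletSpace E a) :=
  inferInstanceAs (InnerProductSpace ℂ (RKHS.OfKernel (ballKernel E (dirichletFun a))))

instance (a : ℝ≥0) : CompleteSpace (DirichletSpace E a) :=
  inferInstanceAs (CompleteSpace (RKHS.OfKernel (ballKernel E (dirichletFun a))))

instance (a : ℝ≥0) : RKHS ℂ (DirichletSpace E a) (OpenUnitBall E) ℂ :=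
  inferInstanceAs (RKHS ℂ (RKHS.OfKernel (ballKernel E (dirichletFun a))) (OpenUnitBall E) ℂ)

theorem kernel_besovSpace (s : ℝ) :
    RKHS.kernel (BesovSpace E s) = ballKernel E (besovFun s) :=
  RKHS.OfKernel.kernel_ofKernel (K := ballKernel E (besovFun s))

theorem kernel_dirichletSpace (a : ℝ≥0) :
    RKHS.kernel (DirichletSpace E a) = ballKernel E (dirichletFun a) :=
  RKHS.OfKernel.kernel_ofKernel (K := ballKernel E (dirichletFun a))

end Spaces

/-! ### Multipliers -/

section Multipliers

variable {X : Type*} (H : Type*) [NormedAddCommGroup H] [InnerProductSpace ℂ H] [RKHS ℂ H X ℂ]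

/-- The multiplier algebra `Mult(H)`: all functions `φ : X → ℂ` such that `φ f ∈ H` for every
`f ∈ H`. -/
def Mult : Subalgebra ℂ (X → ℂ) where
  carrier := {φ | ∀ f : H, ∃ g : H, ∀ x, g x = φ x * f x}
  mul_mem' {φ ψ} hφ hψ f := by
    obtain ⟨g, hg⟩ := hψ f
    obtain ⟨k, hk⟩ := hφ g
    exact ⟨k, fun x => by simp [hk, hg, mul_assoc]⟩
  add_mem' {φ ψ} hφ hψ f := by
    obtain ⟨g, hg⟩ := hφ f
    obtain ⟨k, hk⟩ := hψ f
    exact ⟨g + k, fun x => by simp [hk, hg, add_mul]⟩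
  algebraMap_mem' c f := ⟨c • f, fun x => by simp⟩

variable {H} in
theorem exists_mul_apply (φ : Mult H) (f : H) : ∃ g : H, ∀ x, g x = φ.1 x * f x := φ.2 f

variable {H} in
/-- Multiplication by `φ` as a linear map on `H`. -/
def multLinearMap (φ : Mult H) : H →ₗ[ℂ] H where
  toFun f := (exists_mul_apply φ f).choose
  map_add' f g := by
    ext x
    rw [(exists_mul_apply φ (f + g)).choose_spec]
    simp [(exists_mul_apply φ f).choose_spec, (exists_mul_apply φ g).choose_spec, mul_add]
  map_smul' c f := by
    ext x
    rw [(exists_mul_apply φ (c • f)).choose_spec]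
    simp [(exists_mul_apply φ f).choose_spec, mul_left_comm]

variable {H} in
theorem multLinearMap_apply (φ : Mult H) (f : H) (x : X) : multLinearMap φ f x = φ.1 x * f x :=
  (exists_mul_apply φ f).choose_spec x

variable [CompleteSpace H]

variable {H} in
/-- The multiplication operator `M_φ f = φ f`, which is bounded by the closed graph theorem. -/
def multOperator (φ : Mult H) : H →L[ℂ] H :=
  ContinuousLinearMap.ofSeqClosedGraph (g := multLinearMap φ) (fun u f k hu hk => by
    ext x
    have h1 := ((RKHS.continuous_eval (𝕜 := ℂ) (H := H) x).tendsto f).comp hu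
    have h2 := ((RKHS.continuous_eval (𝕜 := ℂ) (H := H) x).tendsto k).comp hk
    refine tendsto_nhds_unique h2 ?_
    rw [multLinearMap_apply]
    refine (h1.const_mul (φ.1 x)).congr fun n => ?_
    simp [multLinearMap_apply])

variable {H} in
@[simp]
theorem multOperator_apply (φ : Mult H) (f : H) (x : X) : multOperator φ f x = φ.1 x * f x :=
  multLinearMap_apply φ f x

/-- The identification `φ ↦ M_φ` of `Mult(H)` with an algebra of bounded operators on `H`. -/
def multRep : Mult H →ₐ[ℂ] (H →L[ℂ] H) where
  toFun := multOperator
  map_one' := by ext f x; simp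
  map_mul' φ ψ := by ext f x; simp [mul_assoc]
  map_zero' := by ext f x; simp
  map_add' φ ψ := by ext f x; simp [add_mul]
  commutes' c := by ext f x; simp [Algebra.algebraMap_eq_smul_one]

end Multipliers

/-! ### Completely bounded maps -/

section CompletelyBounded

variable {H : Type*} [NormedAddCommGroup H] [InnerProductSpace ℂ H]
variable {K : Type*} [NormedAddCommGroup K] [InnerProductSpace ℂ K]

/-- The operator on the Hilbert space direct sum `H ^ n` given by an `n × n` matrix `T` of bounded
operators on `H`: `(T f) i = ∑ j, T i j (f j)`. -/
def matrixOperator {n : ℕ} (T : Matrix (Fin n) (Fin n) (H →L[ℂ] H)) :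
    PiLp 2 (fun _ : Fin n => H) →L[ℂ] PiLp 2 (fun _ : Fin n => H) :=
  (PiLp.continuousLinearEquiv 2 ℂ fun _ : Fin n => H).symm.toContinuousLinearMap ∘L
    ContinuousLinearMap.pi fun i => ∑ j, T i j ∘L PiLp.proj 2 (fun _ : Fin n => H) j

theorem matrixOperator_apply {n : ℕ} (T : Matrix (Fin n) (Fin n) (H →L[ℂ] H))
    (f : PiLp 2 (fun _ : Fin n => H)) (i : Fin n) :
    matrixOperator T f i = ∑ j, T i j (f j) := by
  simp [matrixOperator]

variable {A : Type*} {B : Type*}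

/-- Let `A` and `B` be vector spaces of bounded operators on `H` and `K`, realized through `ι` and
`κ`, so that `M_n(A)` is normed as a space of operators on `H ^ n`, and similarly for `B`. The linear
map `π : A → B` is completely bounded if its entrywise amplifications `M_n(A) → M_n(B)` are bounded
with a bound that does not depend on `n`. -/
def IsCompletelyBounded [AddCommGroup A] [Module ℂ A] [AddCommGroup B] [Module ℂ B]
    (ι : A →ₗ[ℂ] (H →L[ℂ] H)) (κ : B →ₗ[ℂ] (K →L[ℂ] K)) (π : A →ₗ[ℂ] B) : Prop :=
  ∃ C : ℝ, ∀ (n : ℕ) (M : Matrix (Fin n) (Fin n) A),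
    ‖matrixOperator ((M.map π).map κ)‖ ≤ C * ‖matrixOperator (M.map ι)‖

/-- The homomorphism `π : A → B` of operator algebras is a completely bounded isomorphism onto its
image: it is injective, it is completely bounded, and the inverse map `π(A) → A` is completely
bounded. -/
def IsCompletelyBoundedIsoOntoImage [Ring A] [Algebra ℂ A] [Ring B] [Algebra ℂ B]
    (ι : A →ₐ[ℂ] (H →L[ℂ] H)) (κ : B →ₐ[ℂ] (K →L[ℂ] K)) (π : A →ₐ[ℂ] B) : Prop :=
  IsCompletelyBounded ι.toLinearMap κ.toLinearMap π.toLinearMap ∧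
  ∃ h : Function.Injective π,
    IsCompletelyBounded (κ.comp π.range.val).toLinearMap ι.toLinearMap
      (AlgEquiv.ofInjective π h).symm.toLinearMap

end CompletelyBounded

/-! ### The map `τ` -/

section Tau

theorem norm_tau_lt_one {d : ℕ} [NeZero d] (z : OpenUnitBall (EuclideanSpace ℂ (Fin d))) :
    ‖(((d : ℝ) ^ ((d : ℝ) / 2) : ℝ) : ℂ) * ∏ j, (z : EuclideanSpace ℂ (Fin d)) j‖ < 1 := by
  set x : EuclideanSpace ℂ (Fin d) := z.1
  have hx : ‖x‖ < 1 := mem_ball_zero_iff.mp z.2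
  have hd : (0 : ℝ) < d := by exact_mod_cast Nat.pos_of_ne_zero (NeZero.ne d)
  have h := Real.geom_mean_le_arith_mean Finset.univ (fun _ : Fin d => (1 : ℝ))
    (fun j => ‖x j‖ ^ 2) (fun _ _ => zero_le_one) (by simpa using hd) (fun _ _ => sq_nonneg _)
  have hs : ∑ j, ‖x j‖ ^ 2 = ‖x‖ ^ 2 := (EuclideanSpace.norm_sq_eq x).symm
  simp only [Real.rpow_one, one_mul, Finset.sum_const, Finset.card_univ, Fintype.card_fin,
    nsmul_eq_mul, mul_one, hs, Finset.prod_pow] at h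
  have hP : 0 ≤ ∏ j, ‖x j‖ := Finset.prod_nonneg fun _ _ => norm_nonneg _
  have h2 : (∏ j, ‖x j‖) ^ 2 ≤ (‖x‖ ^ 2 / d) ^ (d : ℝ) := by
    have h3 := Real.rpow_le_rpow (by positivity) h hd.le
    rwa [← Real.rpow_mul (by positivity), inv_mul_cancel₀ hd.ne', Real.rpow_one] at h3
  have h4 : (‖x‖ ^ 2 / d) ^ (d : ℝ) < (1 / d) ^ (d : ℝ) := by
    refine Real.rpow_lt_rpow (by positivity) ?_ hd
    gcongr
    nlinarith [norm_nonneg x]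
  rw [norm_mul, norm_prod, Complex.norm_real, Real.norm_of_nonneg (by positivity)]
  refine lt_of_pow_lt_pow_left₀ 2 zero_le_one ?_
  have h5 : ((d : ℝ) ^ ((d : ℝ) / 2)) ^ 2 = (d : ℝ) ^ (d : ℝ) := by
    rw [← Real.rpow_natCast, ← Real.rpow_mul hd.le]
    norm_num
  rw [mul_pow, h5]
  calc (d : ℝ) ^ (d : ℝ) * (∏ j, ‖x j‖) ^ 2 < (d : ℝ) ^ (d : ℝ) * (1 / d) ^ (d : ℝ) := by
        gcongr
        exact h2.trans_lt h4
    _ = 1 ^ 2 := by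
        rw [← Real.mul_rpow hd.le (by positivity), mul_one_div_cancel hd.ne']
        simp

/-- The map `τ : 𝔹_d → 𝔻`, `τ z = d ^ (d / 2) * z_1 * ⋯ * z_d`. -/
def tau (d : ℕ) [NeZero d] (z : OpenUnitBall (EuclideanSpace ℂ (Fin d))) : OpenUnitBall ℂ :=
  ⟨(((d : ℝ) ^ ((d : ℝ) / 2) : ℝ) : ℂ) * ∏ j, (z : EuclideanSpace ℂ (Fin d)) j,
    mem_ball_zero_iff.mpr (norm_tau_lt_one z)⟩

end Tau

end

/-! ### Positive semidefinite matrices over arbitrary index types -/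

namespace Matrix

variable {Y Z : Type*}

/-! A matrix-valued function `Φ` multiplies the space with kernel `K`, with norm at most `√C`,
exactly when `(C - Φ(z) Φ(w)ᴴ) K(z, w)` is positive semidefinite (`isKernelMultiplier_of_norm_le`,
`exists_operator_of_isKernelMultiplier`). Bounds obtained in this form for matrices of every size,
with a constant independent of the size, are complete bounds, so everything reduces to kernels.

Group the monomials of a kernel `∑ c n ⟨z, w⟩ ^ n` on the ball by writing each multi-index as `β +
(n, …, n)` with `min β = 0`. This gives `∑ β, z ^ β * star (w ^ β) * K_β (τ z, τ w)`, where `K_β` is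
the kernel on the disc with coefficients `ballCoeff c β` (`hasSum_psKernel_tau`). By Stirling's
formula the coefficients for `β = 0` have the size of those of the disc space, and this is where the
loss `(d - 1) / 2` comes from.

From the disc to the ball it suffices, by Schur products and summation over `β`, that a multiplier
of the disc space multiplies every `K_β` with a bound uniform in `β`. A multiplier survives a shift
of the coefficients (`IsKernelMultiplier.shift`), hence, by summation by parts, also multiplication
of the coefficients by an increasing weight. So it is enough that `ballCoeff c β n / a n` increases
in `n` up to a constant independent of `β`. Up to constants this quotient is a quotient of
multinomial coefficients, which increases, times a power of a quotient of degrees, which may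
decrease; a sharpened arithmetic-geometric mean inequality shows that the growth makes up for the
decay when `|β|` is large, while for bounded `|β|` the decay is bounded
(`exists_almost_monotone_pow`).

From the ball to the disc, averaging the kernel over coordinate rotations with product one leaves `Φ
∘ τ` unchanged and retains in the limit only the term `β = 0` (`tendsto_averagedKernel`). Since `τ`
is onto, the resulting positivity descends to the disc. -/

theorem posSemidef_iff_forall_sum {M : Matrix Y Y ℂ} :
    M.PosSemidef ↔ M.IsHermitian ∧ ∀ (s : Finset Y) (c : Y → ℂ),
      0 ≤ ∑ i ∈ s, ∑ j ∈ s, star (c i) * M i j * c j := by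
  refine and_congr_right fun _ => ⟨fun h s c => ?_, fun h x => h x.support x⟩
  classical
  have h1 := h (Finsupp.onFinset s (fun i => if i ∈ s then c i else 0)
    (by simp +contextual))
  rw [Finsupp.onFinset_sum _ (by simp)] at h1
  refine h1.trans_eq (Finset.sum_congr rfl fun i hi => ?_)
  rw [Finsupp.onFinset_sum _ (by simp)]
  exact Finset.sum_congr rfl fun j hj => by simp [hi, hj]

/-- The points `y i` may repeat, which is what congruences by non-injective maps require. -/
theorem PosSemidef.sum_nonneg {M : Matrix Y Y ℂ} (hM : M.PosSemidef) {ι : Type*} (s : Finset ι)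
    (y : ι → Y) (c : ι → ℂ) : 0 ≤ ∑ i ∈ s, ∑ j ∈ s, star (c i) * M (y i) (y j) * c j :=
  (posSemidef_iff_forall_sum.mp (hM.submatrix y)).2 s c

/-- The Gram matrix of a family of vectors indexed by any type. -/
theorem posSemidef_of_inner {E : Type*} [NormedAddCommGroup E] [InnerProductSpace ℂ E]
    (u : Y → E) : (Matrix.of fun x y => inner ℂ (u x) (u y)).PosSemidef := by
  refine posSemidef_iff_forall_sum.mpr ⟨Matrix.ext fun x y => inner_conj_symm _ _, fun s c => ?_⟩
  have h : ∑ i ∈ s, ∑ j ∈ s, star (c i) * (Matrix.of fun x y => inner ℂ (u x) (u y)) i j * c j =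
      inner ℂ (∑ i ∈ s, c i • u i) (∑ i ∈ s, c i • u i) := by
    rw [sum_inner]
    refine Finset.sum_congr rfl fun i _ => ?_
    rw [inner_sum]
    refine Finset.sum_congr rfl fun j _ => ?_
    rw [inner_smul_left, inner_smul_right, Matrix.of_apply, ← RCLike.star_def]
    ring
  rw [h, inner_self_eq_norm_sq_to_K]
  exact pow_nonneg (Complex.zero_le_real.mpr (norm_nonneg (∑ i ∈ s, c i • u i))) 2

theorem posSemidef_mul_star (f : Y → ℂ) : (Matrix.of fun x y => f x * star (f y)).PosSemidef := by
  have h := posSemidef_of_inner (fun x => star (f x))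
  convert h using 3 with x y
  simp [mul_comm]

theorem posSemidef_one_pullback [DecidableEq Z] (f : Y → Z) :
    (Matrix.of fun x y => (1 : Matrix Z Z ℂ) (f x) (f y)).PosSemidef :=
  (PosSemidef.one (n := Z) (R := ℂ)).submatrix f

theorem posSemidef_of_tendsto {ι : Type*} {l : Filter ι} [l.NeBot] {M : ι → Matrix Y Y ℂ}
    {N : Matrix Y Y ℂ} (hM : ∀ᶠ i in l, (M i).PosSemidef)
    (h : ∀ x y, Filter.Tendsto (fun i => M i x y) l (nhds (N x y))) : N.PosSemidef := by
  refine posSemidef_iff_forall_sum.mpr ⟨Matrix.ext fun x y => ?_, fun s c => ?_⟩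
  · refine tendsto_nhds_unique (((h y x).star).congr' ?_) (h x y)
    filter_upwards [hM] with i hi
    exact hi.1.apply x y
  · have ht : Filter.Tendsto (fun i => ∑ a ∈ s, ∑ b ∈ s, star (c a) * M i a b * c b) l
        (nhds (∑ a ∈ s, ∑ b ∈ s, star (c a) * N a b * c b)) :=
      tendsto_finsetSum _ fun a _ => tendsto_finsetSum _ fun b _ =>
        ((h a b).const_mul _).mul_const _
    refine ge_of_tendsto ht ?_
    filter_upwards [hM] with i hi
    exact (posSemidef_iff_forall_sum.mp hi).2 s c

theorem posSemidef_of_hasSum {ι : Type*} {M : ι → Matrix Y Y ℂ} {N : Matrix Y Y ℂ}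
    (hM : ∀ i, (M i).PosSemidef) (h : ∀ x y, HasSum (fun i => M i x y) (N x y)) :
    N.PosSemidef := by
  refine posSemidef_of_tendsto (l := Filter.atTop) (M := fun s : Finset ι => ∑ i ∈ s, M i)
    (Filter.Eventually.of_forall fun s => posSemidef_sum s fun i _ => hM i) fun x y => ?_
  simpa only [Matrix.sum_apply, HasSum, SummationFilter.unconditional_filter] using h x y

/-- Congruence of a positive semidefinite matrix by a matrix with finitely many nonzero entries in
each row. -/
theorem PosSemidef.congruence {M : Matrix Y Y ℂ} (hM : M.PosSemidef) {A : Type*} [Fintype A]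
    (r : A → ℂ) (ρ : A → Z → Y) :
    (Matrix.of fun x y => ∑ a, ∑ b, r a * star (r b) * M (ρ a x) (ρ b y)).PosSemidef := by
  refine posSemidef_iff_forall_sum.mpr ⟨Matrix.ext fun x y => ?_, fun s c => ?_⟩
  · simp only [Matrix.conjTranspose_apply, Matrix.of_apply, star_sum, star_mul', star_star]
    rw [Finset.sum_comm]
    refine Finset.sum_congr rfl fun a _ => Finset.sum_congr rfl fun b _ => ?_
    rw [hM.1.apply, mul_comm (star (r b))]
  · have h := hM.sum_nonneg (Finset.univ ×ˢ s) (fun p : A × Z => ρ p.1 p.2)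
      (fun p => star (r p.1) * c p.2)
    refine h.trans_eq ?_
    simp only [Finset.sum_product, Matrix.of_apply, Finset.mul_sum, Finset.sum_mul]
    rw [Finset.sum_comm]
    refine Finset.sum_congr rfl fun i _ => ?_
    rw [Finset.sum_comm]
    rw [Finset.sum_comm]
    conv_rhs => rw [Finset.sum_comm]
    refine Finset.sum_congr rfl fun a _ => ?_
    rw [Finset.sum_comm]
    refine Finset.sum_congr rfl fun j _ => Finset.sum_congr rfl fun b _ => ?_
    simp only [star_mul', star_star]
    ring

end Matrix

/-! ### Matrix-valued functions that multiply a kernel boundedly -/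

section KernelMultipliers

variable {X X' ι : Type*} [Fintype ι]

/-- A sum of rank-one kernels, one for each column of `Φ`. -/
theorem posSemidef_apply_mul_conjTranspose (Φ : X → Matrix ι ι ℂ) :
    (Matrix.of fun x y : X × ι => (Φ x.1 * (Φ y.1).conjTranspose) x.2 y.2).PosSemidef := by
  have h := Matrix.posSemidef_sum (Finset.univ : Finset ι) (x := fun r =>
    (Matrix.of fun x y : X × ι => Φ x.1 x.2 r * star (Φ y.1 y.2 r)))
    fun r _ => Matrix.posSemidef_mul_star (fun x : X × ι => Φ x.1 x.2 r)
  convert h using 1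
  ext x y
  simp [Matrix.mul_apply, Matrix.sum_apply]

variable [DecidableEq ι]

/-- The matrix `(C - Φ(z) Φ(w)ᴴ) K(z, w)`, with scalar entries. -/
def multiplierKernel (K : X → X → ℂ) (Φ : X → Matrix ι ι ℂ) (C : ℝ) :
    Matrix (X × ι) (X × ι) ℂ :=
  Matrix.of fun x y => K x.1 y.1 *
    ((C : ℂ) * (1 : Matrix ι ι ℂ) x.2 y.2 - (Φ x.1 * (Φ y.1).conjTranspose) x.2 y.2)

theorem multiplierKernel_apply (K : X → X → ℂ) (Φ : X → Matrix ι ι ℂ) (C : ℝ) (x y : X × ι) :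
    multiplierKernel K Φ C x y = K x.1 y.1 *
      ((C : ℂ) * (1 : Matrix ι ι ℂ) x.2 y.2 - (Φ x.1 * (Φ y.1).conjTranspose) x.2 y.2) := rfl

/-- The matrix-valued function `Φ` is a multiplier, with norm at most `√C`, of the space with
reproducing kernel `K`. -/
def IsKernelMultiplier (K : X → X → ℂ) (Φ : X → Matrix ι ι ℂ) (C : ℝ) : Prop :=
  (multiplierKernel K Φ C).PosSemidef

/-- The scalar kernel `K` is positive semidefinite. -/
def IsPosKernel (K : X → X → ℂ) : Prop := (Matrix.of K).PosSemidef

namespace IsKernelMultiplier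

variable {K K' : X → X → ℂ} {Φ : X → Matrix ι ι ℂ} {C : ℝ}

theorem pullback (h : IsKernelMultiplier K Φ C) (τ : X' → X) :
    IsKernelMultiplier (fun z w => K (τ z) (τ w)) (fun z => Φ (τ z)) C :=
  Matrix.PosSemidef.submatrix h fun x : X' × ι => (τ x.1, x.2)

theorem of_pullback {τ : X' → X} (hτ : Function.Surjective τ)
    (h : IsKernelMultiplier (fun z w => K (τ z) (τ w)) (fun z => Φ (τ z)) C) :
    IsKernelMultiplier K Φ C := by
  have h1 := h.pullback (Function.surjInv hτ)
  simpa only [Function.surjInv_eq hτ] using h1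

/-- Schur product theorem: the constant `C` does not change. -/
theorem mul_posKernel (h : IsKernelMultiplier K Φ C) (hK' : IsPosKernel K') :
    IsKernelMultiplier (fun z w => K' z w * K z w) Φ C := by
  have h1 : (Matrix.of fun x y : X × ι => K' x.1 y.1).PosSemidef :=
    Matrix.PosSemidef.submatrix hK' Prod.fst
  have h2 := h1.hadamard h
  have e : multiplierKernel (fun z w => K' z w * K z w) Φ C =
      (Matrix.of fun x y : X × ι => K' x.1 y.1).hadamard (multiplierKernel K Φ C) := by
    ext x y
    simp [Matrix.hadamard, multiplierKernel_apply, mul_assoc]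
  rw [IsKernelMultiplier, e]
  exact h2

theorem of_hasSum {α : Type*} {L : α → X → X → ℂ} (hL : ∀ i, IsKernelMultiplier (L i) Φ C)
    (h : ∀ z w, HasSum (fun i => L i z w) (K z w)) : IsKernelMultiplier K Φ C :=
  Matrix.posSemidef_of_hasSum hL fun x y => by
    simpa only [multiplierKernel_apply] using (h x.1 y.1).mul_right _

theorem of_tendsto {α : Type*} {l : Filter α} [l.NeBot] {L : α → X → X → ℂ}
    (hL : ∀ᶠ i in l, IsKernelMultiplier (L i) Φ C)
    (h : ∀ z w, Filter.Tendsto (fun i => L i z w) l (nhds (K z w))) :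
    IsKernelMultiplier K Φ C :=
  Matrix.posSemidef_of_tendsto hL fun x y => by
    simpa only [multiplierKernel_apply] using (h x.1 y.1).mul_const _

/-- Passage to an equivalent kernel: if `m K ≤ K' ≤ M K`, then multipliers of `K` are multipliers
of `K'`. -/
theorem of_equivalent {m M : ℝ} (h : IsKernelMultiplier K Φ C) (hm : 0 < m) (hM : 0 ≤ M)
    (hC : 0 ≤ C) (h1 : IsPosKernel fun z w => K' z w - m * K z w)
    (h2 : IsPosKernel fun z w => M * K z w - K' z w) :
    IsKernelMultiplier K' Φ (M / m * C) := by
  have p1 : (Matrix.of fun x y : X × ι => (K' x.1 y.1 - m * K x.1 y.1)).PosSemidef :=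
    Matrix.PosSemidef.submatrix h1 Prod.fst
  have p2 : (Matrix.of fun x y : X × ι => (M * K x.1 y.1 - K' x.1 y.1)).PosSemidef :=
    Matrix.PosSemidef.submatrix h2 Prod.fst
  -- The target is the sum of three positive kernels: `(M C / m) (K' - m K)` times the identity, `(M
  -- K - K') Φ Φᴴ`, and `M (C - Φ Φᴴ) K`.
  have q1 := (p1.hadamard (Matrix.posSemidef_one_pullback (Prod.snd : X × ι → ι))).smul
    (a := (((M / m * C : ℝ)) : ℂ)) (by rw [Complex.zero_le_real]; positivity)
  have q2 := p2.hadamard (posSemidef_apply_mul_conjTranspose Φ)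
  have q3 := Matrix.PosSemidef.smul h (a := (M : ℂ)) (by rw [Complex.zero_le_real]; positivity)
  have q := (q1.add q2).add q3
  refine (congrArg Matrix.PosSemidef (Matrix.ext fun x y => ?_)).mpr q
  have : (m : ℂ) ≠ 0 := by exact_mod_cast hm.ne'
  simp only [multiplierKernel_apply, Matrix.add_apply, Matrix.smul_apply, Matrix.hadamard_apply,
    Matrix.of_apply, smul_eq_mul, Complex.ofReal_mul, Complex.ofReal_div]
  field_simp
  ring

end IsKernelMultiplier

end KernelMultipliers

/-! ### Multipliers of reproducing kernel Hilbert spaces and their kernels -/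

section GramExtension

theorem ofReal_norm_sq_eq_inner {E : Type*} [NormedAddCommGroup E] [InnerProductSpace ℂ E] (x : E) :
    ((‖x‖ ^ 2 : ℝ) : ℂ) = inner ℂ x x := by
  rw [inner_self_eq_norm_sq_to_K]
  exact Complex.ofReal_pow _ _

variable {𝓗 𝓚 Y : Type*} [NormedAddCommGroup 𝓗] [InnerProductSpace ℂ 𝓗]
  [NormedAddCommGroup 𝓚] [InnerProductSpace ℂ 𝓚]

/-- If the Gram matrix of `v` is dominated by `C` times the Gram matrix of the total family `u`,
there is a bounded operator that maps each `u y` to `v y`. -/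
theorem exists_clm_of_posSemidef [CompleteSpace 𝓗] [CompleteSpace 𝓚] (u : Y → 𝓗) (v : Y → 𝓚) (C : ℝ)
    (hu : ∀ f : 𝓗, (∀ y, inner ℂ (u y) f = 0) → f = 0)
    (h : (Matrix.of fun x y => (C : ℂ) * inner ℂ (u x) (u y) - inner ℂ (v x) (v y)).PosSemidef) :
    ∃ S : 𝓗 →L[ℂ] 𝓚, (∀ y, S (u y) = v y) ∧ ‖S‖ ≤ Real.sqrt C := by
  -- The span of `u` is dense because its orthogonal complement is trivial by `hu`.
  have hd : DenseRange (Finsupp.linearCombination ℂ u) := by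
    have h1 : Submodule.topologicalClosure (LinearMap.range (Finsupp.linearCombination ℂ u)) = ⊤ := by
      rw [Submodule.topologicalClosure_eq_top_iff, Submodule.eq_bot_iff]
      intro f hf
      refine hu f fun y => hf _ ⟨Finsupp.single y 1, by simp⟩
    have h2 := congrArg (fun V : Submodule ℂ 𝓗 => (V : Set 𝓗)) h1
    rw [DenseRange, dense_iff_closure_eq]
    rwa [Submodule.topologicalClosure_coe, LinearMap.coe_range] at h2
  have hb : ∀ x : Y →₀ ℂ, ‖Finsupp.linearCombination ℂ v x‖ ≤
      Real.sqrt C * ‖Finsupp.linearCombination ℂ u x‖ := by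
    intro x
    have h1 := (Matrix.posSemidef_iff_forall_sum.mp h).2 x.support x
    have e : ∑ i ∈ x.support, ∑ j ∈ x.support, star (x i) * (Matrix.of fun x y =>
        (C : ℂ) * inner ℂ (u x) (u y) - inner ℂ (v x) (v y)) i j * x j =
        ((C * ‖Finsupp.linearCombination ℂ u x‖ ^ 2 -
          ‖Finsupp.linearCombination ℂ v x‖ ^ 2 : ℝ) : ℂ) := by
      rw [Complex.ofReal_sub, Complex.ofReal_mul, ofReal_norm_sq_eq_inner,
        ofReal_norm_sq_eq_inner]
      simp only [Finsupp.linearCombination_apply, Finsupp.sum, sum_inner]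
      simp only [inner_sum]
      rw [Finset.mul_sum, ← Finset.sum_sub_distrib]
      refine Finset.sum_congr rfl fun i _ => ?_
      rw [Finset.mul_sum, ← Finset.sum_sub_distrib]
      refine Finset.sum_congr rfl fun j _ => ?_
      simp only [inner_smul_left, inner_smul_right, Matrix.of_apply, ← RCLike.star_def]
      ring
    rw [e, Complex.zero_le_real] at h1
    rcases le_or_gt 0 C with hC | hC
    · refine (sq_le_sq₀ (norm_nonneg _) (by positivity)).mp ?_
      rw [mul_pow, Real.sq_sqrt hC]
      linarith
    -- For negative `C` the square root is `0`, and positivity forces all combinations of `v` to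
    -- vanish.
    · have : ‖Finsupp.linearCombination ℂ v x‖ ^ 2 ≤ 0 := by
        nlinarith [sq_nonneg ‖Finsupp.linearCombination ℂ u x‖]
      have h3 : ‖Finsupp.linearCombination ℂ v x‖ = 0 := by
        nlinarith [norm_nonneg (Finsupp.linearCombination ℂ v x)]
      rw [h3]
      positivity
  refine ⟨(Finsupp.linearCombination ℂ v).extendOfNorm (Finsupp.linearCombination ℂ u),
    fun y => ?_, LinearMap.opNorm_extendOfNorm_le hd (Real.sqrt_nonneg _) hb⟩
  have := LinearMap.extendOfNorm_eq hd ⟨_, hb⟩ (Finsupp.single y 1)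
  simpa using this

theorem posSemidef_of_norm_le (T : 𝓗 →L[ℂ] 𝓚) {B : ℝ} (hB : ‖T‖ ≤ B) (u : Y → 𝓗) :
    (Matrix.of fun x y => ((B ^ 2 : ℝ) : ℂ) * inner ℂ (u x) (u y) -
      inner ℂ (T (u x)) (T (u y))).PosSemidef := by
  refine Matrix.posSemidef_iff_forall_sum.mpr ⟨Matrix.ext fun x y => ?_, fun s c => ?_⟩
  · simp only [Matrix.conjTranspose_apply, Matrix.of_apply, star_sub, star_mul', RCLike.star_def,
      inner_conj_symm, Complex.conj_ofReal]
  · have e : ∑ i ∈ s, ∑ j ∈ s, star (c i) * (Matrix.of fun x y =>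
        ((B ^ 2 : ℝ) : ℂ) * inner ℂ (u x) (u y) - inner ℂ (T (u x)) (T (u y))) i j * c j =
        ((B ^ 2 * ‖∑ i ∈ s, c i • u i‖ ^ 2 - ‖T (∑ i ∈ s, c i • u i)‖ ^ 2 : ℝ) : ℂ) := by
      rw [Complex.ofReal_sub, Complex.ofReal_mul, ofReal_norm_sq_eq_inner,
        ofReal_norm_sq_eq_inner, map_sum]
      simp only [sum_inner]
      simp only [inner_sum, map_smul]
      rw [Finset.mul_sum, ← Finset.sum_sub_distrib]
      refine Finset.sum_congr rfl fun i _ => ?_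
      rw [Finset.mul_sum, ← Finset.sum_sub_distrib]
      refine Finset.sum_congr rfl fun j _ => ?_
      simp only [inner_smul_left, inner_smul_right, Matrix.of_apply, ← RCLike.star_def]
      ring
    rw [e, Complex.zero_le_real, sub_nonneg, ← mul_pow]
    gcongr
    exact T.le_of_opNorm_le hB _

end GramExtension

/-! ### Kernel vectors in `H ^ n` and adjoints of multiplication operators -/

section KernelVectors

variable {X : Type*} {H : Type*} [NormedAddCommGroup H] [InnerProductSpace ℂ H] [RKHS ℂ H X ℂ]
  [CompleteSpace H] {n : ℕ}

variable (H) in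
/-- The vector in `H ^ n` whose inner product with `f` is `f i x`. -/
noncomputable def kernelVector (n : ℕ) (y : X × Fin n) : PiLp 2 fun _ : Fin n => H :=
  WithLp.toLp 2 (Pi.single y.2 (RKHS.kerFun H y.1 1))

theorem inner_kernelVector (y : X × Fin n) (f : PiLp 2 fun _ : Fin n => H) :
    inner ℂ (kernelVector H n y) f = f y.2 y.1 := by
  rw [PiLp.inner_apply, Finset.sum_eq_single y.2]
  · simp [kernelVector]
  · intro i _ hi
    simp [kernelVector, hi]
  · simp

theorem eq_zero_of_inner_kernelVector (f : PiLp 2 fun _ : Fin n => H)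
    (h : ∀ y : X × Fin n, inner ℂ (kernelVector H n y) f = 0) : f = 0 := by
  ext i x
  have := h (x, i)
  rw [inner_kernelVector] at this
  simpa using this

theorem inner_kernelVector_kernelVector {K : X → X → ℂ}
    (hK : ∀ x y, RKHS.kernel H x y = K x y • ContinuousLinearMap.id ℂ ℂ) (x y : X × Fin n) :
    inner ℂ (kernelVector H n x) (kernelVector H n y) =
      K x.1 y.1 * (1 : Matrix (Fin n) (Fin n) ℂ) x.2 y.2 := by
  rw [inner_kernelVector]
  rcases eq_or_ne x.2 y.2 with h | h
  · rw [h, Matrix.one_apply_eq]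
    simp [kernelVector, RKHS.kerFun_apply, hK]
  · simp [kernelVector, h]

/-- The vector that the adjoint of multiplication by `Φ` assigns to a kernel vector. -/
noncomputable def adjointKernelVector (H : Type*) [NormedAddCommGroup H] [InnerProductSpace ℂ H] [RKHS ℂ H X ℂ]
    [CompleteSpace H] (Φ : X → Matrix (Fin n) (Fin n) ℂ) (y : X × Fin n) :
    PiLp 2 fun _ : Fin n => H :=
  ∑ r, star (Φ y.1 y.2 r) • kernelVector H n (y.1, r)

theorem inner_adjointKernelVector (Φ : X → Matrix (Fin n) (Fin n) ℂ) (y : X × Fin n)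
    (f : PiLp 2 fun _ : Fin n => H) :
    inner ℂ (adjointKernelVector H Φ y) f = ∑ r, Φ y.1 y.2 r * f r y.1 := by
  simp only [adjointKernelVector, sum_inner, inner_smul_left, inner_kernelVector]
  simp

theorem inner_adjointKernelVector_adjointKernelVector {K : X → X → ℂ}
    (hK : ∀ x y, RKHS.kernel H x y = K x y • ContinuousLinearMap.id ℂ ℂ)
    (Φ : X → Matrix (Fin n) (Fin n) ℂ) (x y : X × Fin n) :
    inner ℂ (adjointKernelVector H Φ x) (adjointKernelVector H Φ y) =
      K x.1 y.1 * (Φ x.1 * (Φ y.1).conjTranspose) x.2 y.2 := by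
  simp only [adjointKernelVector, sum_inner, inner_sum, inner_smul_left, inner_smul_right,
    inner_kernelVector_kernelVector hK, Matrix.mul_apply, Matrix.conjTranspose_apply,
    Finset.mul_sum]
  refine Finset.sum_congr rfl fun r _ => ?_
  rw [Finset.sum_eq_single r]
  · simp
    ring
  · intro b _ hb
    simp [Matrix.one_apply_ne hb]
  · simp

/-- The adjoint of a multiplication operator sends kernel vectors to combinations of kernel vectors
at the same point. The bound on its norm, read on Gram matrices, is the asserted positivity. -/
theorem isKernelMultiplier_of_norm_le {K : X → X → ℂ}
    (hK : ∀ x y, RKHS.kernel H x y = K x y • ContinuousLinearMap.id ℂ ℂ)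
    (M : Matrix (Fin n) (Fin n) (Mult H)) {B : ℝ}
    (hB : ‖matrixOperator (M.map (multRep H))‖ ≤ B) :
    IsKernelMultiplier K (fun x => M.map fun φ => φ.1 x) (B ^ 2) := by
  set Φ : X → Matrix (Fin n) (Fin n) ℂ := fun x => M.map fun φ => φ.1 x
  set T := matrixOperator (M.map (multRep H))
  have hT : ∀ y : X × Fin n, T.adjoint (kernelVector H n y) = adjointKernelVector H Φ y := by
    intro y
    refine ext_inner_right ℂ fun f => ?_
    rw [ContinuousLinearMap.adjoint_inner_left, inner_kernelVector, inner_adjointKernelVector,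
      matrixOperator_apply]
    have : ∀ s : Finset (Fin n), (∑ j ∈ s, M.map (multRep H) y.2 j (f j)) y.1 =
        ∑ j ∈ s, Φ y.1 y.2 j * f j y.1 := by
      intro s
      classical
      induction s using Finset.induction_on with
      | empty => simp
      | insert a s ha ih => rw [Finset.sum_insert ha, Finset.sum_insert ha, RKHS.coe_add,
          Pi.add_apply, ih]; congr 1; exact multOperator_apply _ _ _
    exact this _
  have h := posSemidef_of_norm_le T.adjoint
    ((LinearIsometryEquiv.norm_map ContinuousLinearMap.adjoint T).le.trans hB) (kernelVector H n)
  refine (congrArg Matrix.PosSemidef (Matrix.ext fun x y => ?_)).mpr h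
  rw [Matrix.of_apply, hT, hT, inner_kernelVector_kernelVector hK,
    inner_adjointKernelVector_adjointKernelVector hK, multiplierKernel_apply]
  ring

/-- Positivity says that the map prescribed on kernel vectors is bounded. It extends because kernel
vectors are total, and its adjoint is multiplication by `Φ`. No entry of `Φ` is assumed to be a
multiplier, so this also yields membership in the multiplier algebra. -/
theorem exists_operator_of_isKernelMultiplier {K : X → X → ℂ}
    (hK : ∀ x y, RKHS.kernel H x y = K x y • ContinuousLinearMap.id ℂ ℂ)
    {Φ : X → Matrix (Fin n) (Fin n) ℂ} {C : ℝ} (h : IsKernelMultiplier K Φ C) :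
    ∃ T : (PiLp 2 fun _ : Fin n => H) →L[ℂ] (PiLp 2 fun _ : Fin n => H),
      (∀ f i x, T f i x = ∑ r, Φ x i r * f r x) ∧ ‖T‖ ≤ Real.sqrt C := by
  obtain ⟨S, hS, hn⟩ := exists_clm_of_posSemidef (kernelVector H n) (adjointKernelVector H Φ) C
    eq_zero_of_inner_kernelVector (by
      refine (congrArg Matrix.PosSemidef (Matrix.ext fun x y => ?_)).mpr h
      rw [Matrix.of_apply, inner_kernelVector_kernelVector hK,
        inner_adjointKernelVector_adjointKernelVector hK, multiplierKernel_apply]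
      ring)
  refine ⟨S.adjoint, fun f i x => ?_,
    (LinearIsometryEquiv.norm_map ContinuousLinearMap.adjoint S).le.trans hn⟩
  rw [← inner_kernelVector (x, i), ContinuousLinearMap.adjoint_inner_right, hS,
    inner_adjointKernelVector]

theorem mem_mult_of_isKernelMultiplier {K : X → X → ℂ}
    (hK : ∀ x y, RKHS.kernel H x y = K x y • ContinuousLinearMap.id ℂ ℂ)
    {Φ : X → Matrix (Fin 1) (Fin 1) ℂ} {C : ℝ} (h : IsKernelMultiplier K Φ C) :
    (fun x => Φ x 0 0) ∈ Mult H := by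
  obtain ⟨T, hT, -⟩ := exists_operator_of_isKernelMultiplier hK h
  intro f
  refine ⟨T (WithLp.toLp 2 fun _ => f) 0, fun x => ?_⟩
  rw [hT]
  simp

theorem norm_matrixOperator_le_of_isKernelMultiplier {K : X → X → ℂ}
    (hK : ∀ x y, RKHS.kernel H x y = K x y • ContinuousLinearMap.id ℂ ℂ)
    (M : Matrix (Fin n) (Fin n) (Mult H)) {C : ℝ}
    (h : IsKernelMultiplier K (fun x => M.map fun φ => φ.1 x) C) :
    ‖matrixOperator (M.map (multRep H))‖ ≤ Real.sqrt C := by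
  obtain ⟨T, hT, hn⟩ := exists_operator_of_isKernelMultiplier hK h
  convert hn using 2
  ext f i x
  rw [hT, matrixOperator_apply]
  have : ∀ s : Finset (Fin n), (∑ j ∈ s, M.map (multRep H) i j (f j)) x =
      ∑ j ∈ s, M.map (fun φ => φ.1 x) i j * f j x := by
    intro s
    classical
    induction s using Finset.induction_on with
    | empty => simp
    | insert a s ha ih => rw [Finset.sum_insert ha, Finset.sum_insert ha, RKHS.coe_add,
        Pi.add_apply, ih]; congr 1; exact multOperator_apply _ _ _
  exact this _

end KernelVectors

/-! ### Kernels given by power series -/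

section PowerSeriesKernels

open Filter Topology

/-- The power series with coefficients `a` converges absolutely on the open unit disc. -/
def UnitSummable (a : ℕ → ℝ) : Prop := ∀ r : ℝ, 0 ≤ r → r < 1 → Summable fun n => |a n| * r ^ n

/-- The sum of the power series with coefficients `a`. -/
noncomputable def psFun (a : ℕ → ℝ) (x : ℂ) : ℂ := ∑' n, (a n : ℂ) * x ^ n

/-- The kernel `∑ n, a n * ⟨z, w⟩ ^ n` on the unit ball. -/
noncomputable def psKernel (E : Type*) [NormedAddCommGroup E] [InnerProductSpace ℂ E] (a : ℕ → ℝ)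
    (z w : OpenUnitBall E) : ℂ := psFun a (pairing z w)

variable {a b : ℕ → ℝ}

namespace UnitSummable

theorem summable_norm (ha : UnitSummable a) {x : ℂ} (hx : ‖x‖ < 1) :
    Summable fun n => ‖(a n : ℂ) * x ^ n‖ := by
  simpa [norm_mul, norm_pow] using ha ‖x‖ (norm_nonneg _) hx

theorem hasSum (ha : UnitSummable a) {x : ℂ} (hx : ‖x‖ < 1) :
    HasSum (fun n => (a n : ℂ) * x ^ n) (psFun a x) :=
  (ha.summable_norm hx).of_norm.hasSum

theorem of_hasSum {g : ℂ → ℂ} (hg : ∀ x : ℂ, ‖x‖ < 1 → HasSum (fun n => (a n : ℂ) * x ^ n) (g x)) :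
    UnitSummable a := by
  intro r h0 h1
  have h := (hg (r : ℂ) (by simpa [abs_of_nonneg h0] using h1)).summable.norm
  simpa [norm_mul, norm_pow, abs_of_nonneg h0] using h

theorem of_le (ha : UnitSummable a) {M : ℝ} (h : ∀ n, |b n| ≤ M * |a n|) : UnitSummable b := by
  intro r h0 h1
  refine Summable.of_nonneg_of_le (fun n => by positivity) (fun n => ?_)
    ((ha r h0 h1).mul_left M)
  rw [← mul_assoc]
  exact mul_le_mul_of_nonneg_right (h n) (by positivity)

theorem add (ha : UnitSummable a) (hb : UnitSummable b) : UnitSummable fun n => a n + b n := by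
  intro r h0 h1
  refine Summable.of_nonneg_of_le (fun n => by positivity) (fun n => ?_)
    ((ha r h0 h1).add (hb r h0 h1))
  rw [← add_mul]
  exact mul_le_mul_of_nonneg_right (abs_add_le _ _) (by positivity)

theorem const_mul (ha : UnitSummable a) (M : ℝ) : UnitSummable fun n => M * a n :=
  ha.of_le (M := |M|) fun _ => (abs_mul _ _).le

theorem sub (ha : UnitSummable a) (hb : UnitSummable b) : UnitSummable fun n => a n - b n := by
  simpa [sub_eq_add_neg] using ha.add (hb.const_mul (-1))

theorem shift (ha : UnitSummable a) : UnitSummable fun n => a (n + 1) := by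
  intro r h0 h1
  -- The larger radius `(1 + r) / 2` is positive even for `r = 0`, so one power of it can be divided
  -- out.
  have h2 : (0 : ℝ) < (1 + r) / 2 := by linarith
  have h := ((summable_nat_add_iff 1).mpr (ha ((1 + r) / 2) h2.le (by linarith))).mul_right
    ((1 + r) / 2)⁻¹
  refine Summable.of_nonneg_of_le (fun n => by positivity) (fun n => ?_) h
  rw [pow_succ, mul_assoc, mul_assoc, mul_inv_cancel₀ h2.ne', mul_one]
  gcongr
  linarith

theorem shift_by (ha : UnitSummable a) (j : ℕ) : UnitSummable fun n => a (n + j) := by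
  induction j with
  | zero => exact ha
  | succ j ih => simpa only [add_right_comm, add_assoc] using ih.shift

end UnitSummable

theorem psFun_eq_add_mul (ha : UnitSummable a) {x : ℂ} (hx : ‖x‖ < 1) :
    psFun a x = a 0 + x * psFun (fun n => a (n + 1)) x := by
  refine (ha.hasSum hx).unique ?_
  rw [← hasSum_nat_add_iff' 1]
  simp only [Finset.sum_range_one, pow_zero, mul_one, add_sub_cancel_left]
  refine ((ha.shift.hasSum hx).mul_left x).congr_fun fun n => ?_
  ring

theorem psFun_sub (ha : UnitSummable a) (hb : UnitSummable b) {x : ℂ} (hx : ‖x‖ < 1) :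
    psFun (fun n => a n - b n) x = psFun a x - psFun b x := by
  refine ((ha.sub hb).hasSum hx).unique (((ha.hasSum hx).sub (hb.hasSum hx)).congr_fun fun n => ?_)
  push_cast
  ring

theorem psFun_const_mul (ha : UnitSummable a) (M : ℝ) {x : ℂ} (hx : ‖x‖ < 1) :
    psFun (fun n => M * a n) x = M * psFun a x := by
  refine ((ha.const_mul M).hasSum hx).unique (((ha.hasSum hx).mul_left (M : ℂ)).congr_fun
    fun n => ?_)
  push_cast
  ring

/-- Weierstrass test on a disc of radius strictly between `‖x‖` and `1`. -/
theorem continuousAt_psFun (ha : UnitSummable a) {x : ℂ} (hx : ‖x‖ < 1) :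
    ContinuousAt (psFun a) x := by
  obtain ⟨r, h1, h2⟩ := exists_between hx
  have h0 : 0 ≤ r := (norm_nonneg x).trans h1.le
  have h : ContinuousOn (psFun a) (Metric.ball 0 r) := by
    refine continuousOn_tsum (fun n => by fun_prop) (ha r h0 h2) fun n y hy => ?_
    rw [norm_mul, norm_pow, Complex.norm_real, Real.norm_eq_abs]
    gcongr
    exact (mem_ball_zero_iff.mp hy).le
  exact h.continuousAt (Metric.isOpen_ball.mem_nhds (mem_ball_zero_iff.mpr h1))

section Ball

variable {E : Type*} [NormedAddCommGroup E] [InnerProductSpace ℂ E]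

theorem isPosKernel_psKernel (ha : UnitSummable a) (h0 : ∀ n, 0 ≤ a n) :
    IsPosKernel (psKernel E a) :=
  posSemidef_scalar_ballKernel h0 fun _ hx => ha.hasSum hx

/-- Power series kernels with comparable coefficients have the same multipliers. -/
theorem IsKernelMultiplier.of_coeff_equivalent {ι : Type*} [Fintype ι] [DecidableEq ι]
    {Φ : OpenUnitBall E → Matrix ι ι ℂ} {C m M : ℝ} (ha : UnitSummable a) (hb : UnitSummable b)
    (hm : 0 < m) (hM : 0 ≤ M) (hC : 0 ≤ C) (h1 : ∀ n, m * a n ≤ b n) (h2 : ∀ n, b n ≤ M * a n)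
    (h : IsKernelMultiplier (psKernel E a) Φ C) :
    IsKernelMultiplier (psKernel E b) Φ (M / m * C) := by
  refine h.of_equivalent hm hM hC ?_ ?_
  · have := isPosKernel_psKernel (E := E) (hb.sub (ha.const_mul m)) fun n => sub_nonneg.mpr (h1 n)
    convert this using 3 with z w
    change psFun b _ - m * psFun a _ = psFun _ _
    rw [psFun_sub hb (ha.const_mul m) (norm_pairing_lt_one z w),
      psFun_const_mul ha m (norm_pairing_lt_one z w)]
  · have := isPosKernel_psKernel (E := E) ((ha.const_mul M).sub hb) fun n => sub_nonneg.mpr (h2 n)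
    convert this using 3 with z w
    change M * psFun a _ - psFun b _ = psFun _ _
    rw [psFun_sub (ha.const_mul M) hb (norm_pairing_lt_one z w),
      psFun_const_mul ha M (norm_pairing_lt_one z w)]

end Ball

/-! ### The unit disc -/

section Disc

theorem pairing_disc (z w : OpenUnitBall ℂ) : pairing z w = (z : ℂ) * star (w : ℂ) := rfl

theorem tendsto_mul_conjTranspose_apply {ι : Type*} [Fintype ι] {A B : ℕ → Matrix ι ι ℂ} {A' B' : Matrix ι ι ℂ}
    (hA : Tendsto A atTop (𝓝 A')) (hB : Tendsto B atTop (𝓝 B')) (i j : ι) :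
    Tendsto (fun m => (A m * (B m).conjTranspose) i j) atTop
      (𝓝 ((A' * B'.conjTranspose) i j)) := by
  simp only [Matrix.mul_apply, Matrix.conjTranspose_apply]
  exact tendsto_finsetSum _ fun k _ => (((hA.apply_nhds i).apply_nhds k).mul
    ((hB.apply_nhds j).apply_nhds k).star)

/-- The centre of the unit disc. -/
def discZero : OpenUnitBall ℂ := ⟨0, by simp⟩

variable {ι : Type*} [Fintype ι] [DecidableEq ι] {Φ : OpenUnitBall ℂ → Matrix ι ι ℂ} {C : ℝ}

theorem psKernel_discZero_left (ha : UnitSummable a) (w : OpenUnitBall ℂ) :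
    psKernel ℂ a discZero w = a 0 := by
  rw [psKernel, psFun_eq_add_mul ha (norm_pairing_lt_one _ _), pairing_disc]
  simp [discZero]

theorem psKernel_discZero_right (ha : UnitSummable a) (w : OpenUnitBall ℂ) :
    psKernel ℂ a w discZero = a 0 := by
  rw [psKernel, psFun_eq_add_mul ha (norm_pairing_lt_one _ _), pairing_disc]
  simp [discZero]

/-- `K - a 0` is the kernel of the functions vanishing at the origin. Taking differences with the
origin in both variables of `(C - Φ Φᴴ) K` leaves cross terms in `Φ discZero`, since `K` equals `a
0` whenever one variable is the origin; adding `a 0 (Φ z - Φ 0) (Φ w - Φ 0)ᴴ` removes them exactly.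
-/
theorem IsKernelMultiplier.sub_const (ha : UnitSummable a) (h0 : 0 ≤ a 0)
    (h : IsKernelMultiplier (psKernel ℂ a) Φ C) :
    IsKernelMultiplier (fun z w => psKernel ℂ a z w - a 0) Φ C := by
  have h1 := Matrix.PosSemidef.congruence h (fun i : Bool => cond i (1 : ℂ) (-1))
    (fun i (x : OpenUnitBall ℂ × ι) => (cond i x.1 discZero, x.2))
  have h2 := (posSemidef_apply_mul_conjTranspose fun z => Φ z - Φ discZero).smul (a := (a 0 : ℂ))
    (Complex.zero_le_real.mpr h0)
  refine (congrArg Matrix.PosSemidef (Matrix.ext fun x y => ?_)).mpr (h1.add h2)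
  simp only [multiplierKernel_apply, Matrix.add_apply, Matrix.of_apply, Fintype.sum_bool,
    Matrix.smul_apply, cond_true, cond_false, psKernel_discZero_left ha,
    psKernel_discZero_right ha, Matrix.conjTranspose_sub, Matrix.mul_sub, Matrix.sub_mul,
    Matrix.sub_apply, smul_eq_mul, star_one, star_neg]
  ring

theorem tendsto_psKernel (ha : UnitSummable a) {p q : ℕ → OpenUnitBall ℂ} {z w : OpenUnitBall ℂ}
    (hp : Tendsto p atTop (𝓝 z)) (hq : Tendsto q atTop (𝓝 w)) :
    Tendsto (fun m => psKernel ℂ a (p m) (q m)) atTop (𝓝 (psKernel ℂ a z w)) := by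
  have h : Tendsto (fun m => pairing (p m) (q m)) atTop (𝓝 (pairing z w)) := by
    simp only [pairing_disc]
    exact (tendsto_subtype_rng.mp hp).mul (tendsto_subtype_rng.mp hq).star
  exact (continuousAt_psFun ha (norm_pairing_lt_one z w)).tendsto.comp h

/-- Multipliers of the space with kernel `∑ n, a n * ⟨z, w⟩ ^ n` leave the subspace of the functions
that vanish at the origin invariant; in terms of the quotients by the coordinate function, they are
multipliers of the space with the shifted coefficients. -/
theorem IsKernelMultiplier.shift (ha : UnitSummable a) (h0 : 0 ≤ a 0)
    (hΦ : ContinuousAt Φ discZero) (h : IsKernelMultiplier (psKernel ℂ a) Φ C) :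
    IsKernelMultiplier (psKernel ℂ fun n => a (n + 1)) Φ C := by
  -- Division by `z * star w`. As `0⁻¹ = 0`, this gives the shifted kernel only away from the
  -- origin.
  have h1 := (h.sub_const ha h0).mul_posKernel
    (Matrix.posSemidef_mul_star fun z : OpenUnitBall ℂ => (z : ℂ)⁻¹)
  let p : ℕ → OpenUnitBall ℂ := fun m => ⟨((1 / ((m : ℝ) + 1) / 2 : ℝ) : ℂ), by
    rw [mem_ball_zero_iff, Complex.norm_real, Real.norm_of_nonneg (by positivity)]
    have : 1 / ((m : ℝ) + 1) ≤ 1 := by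
      rw [div_le_one (by positivity)]
      linarith [Nat.cast_nonneg (α := ℝ) m]
    linarith⟩
  have hp0 : ∀ m, (p m : ℂ) ≠ 0 := fun m => by
    simp only [p, ne_eq, Complex.ofReal_eq_zero]
    positivity
  have hp : Tendsto p atTop (𝓝 discZero) := by
    rw [tendsto_subtype_rng]
    have := (Complex.continuous_ofReal.tendsto _).comp
      ((tendsto_one_div_add_atTop_nhds_zero_nat (𝕜 := ℝ)).div_const 2)
    rwa [zero_div, Complex.ofReal_zero] at this
  -- The origin is replaced by nonzero points tending to it. The positivity passes to the limit by
  -- continuity of `Φ` at the origin.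
  let ρ : ℕ → OpenUnitBall ℂ → OpenUnitBall ℂ := fun m z => if z = discZero then p m else z
  have hρ0 : ∀ m z, (ρ m z : ℂ) ≠ 0 := fun m z => by
    by_cases hz : z = discZero
    · simp only [ρ, hz, if_true]
      exact hp0 m
    · simp only [ρ, hz, if_false]
      exact fun h => hz (Subtype.ext h)
  have hρ : ∀ z, Tendsto (fun m => ρ m z) atTop (𝓝 z) := fun z => by
    by_cases hz : z = discZero
    · simpa only [ρ, hz, if_true] using hp
    · simpa only [ρ, hz, if_false] using tendsto_const_nhds
  have hΦρ : ∀ z, Tendsto (fun m => Φ (ρ m z)) atTop (𝓝 (Φ z)) := fun z => by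
    by_cases hz : z = discZero
    · simp only [ρ, hz, if_true]
      exact hΦ.tendsto.comp hp
    · simpa only [ρ, hz, if_false] using tendsto_const_nhds
  refine Matrix.posSemidef_of_tendsto (l := atTop)
    (Eventually.of_forall fun m => h1.pullback (ρ m)) fun x y => ?_
  simp only [multiplierKernel_apply]
  have e : ∀ m, (Matrix.of fun x y : OpenUnitBall ℂ => (x : ℂ)⁻¹ * star (y : ℂ)⁻¹)
      (ρ m x.1) (ρ m y.1) * (psKernel ℂ a (ρ m x.1) (ρ m y.1) - a 0) =
      psKernel ℂ (fun n => a (n + 1)) (ρ m x.1) (ρ m y.1) := by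
    intro m
    have hy : star (ρ m y.1 : ℂ) ≠ 0 := star_ne_zero.mpr (hρ0 m y.1)
    rw [psKernel, psFun_eq_add_mul ha (norm_pairing_lt_one _ _), Matrix.of_apply, psKernel,
      add_sub_cancel_left, pairing_disc, star_inv₀]
    field_simp [hρ0 m x.1]
  exact ((tendsto_psKernel ha.shift (hρ x.1) (hρ y.1)).congr fun m => (e m).symm).mul
    (tendsto_const_nhds.sub (tendsto_mul_conjTranspose_apply (hΦρ x.1) (hΦρ y.1) x.2 y.2))

theorem IsKernelMultiplier.shift_by (ha : UnitSummable a) (h0 : ∀ n, 0 ≤ a n)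
    (hΦ : ContinuousAt Φ discZero) (h : IsKernelMultiplier (psKernel ℂ a) Φ C) (j : ℕ) :
    IsKernelMultiplier (psKernel ℂ fun n => a (n + j)) Φ C := by
  induction j with
  | zero => exact h
  | succ j ih =>
    simpa only [add_right_comm, add_assoc] using ih.shift (ha.shift_by j) (h0 _) hΦ

end Disc

end PowerSeriesKernels

/-! ### Multipliers under increasing weights on the coefficients -/

section MonotoneWeights

open Filter Topology

/-- Interchanging two summations, with finitely supported inner sums in one order. -/
theorem hasSum_of_finite_inner {ι κ : Type*} {F : ι → κ → ℂ} {g : κ → ℂ} {u : ι → ℂ} {S : ℂ}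
    (s : ι → Finset κ) (hF : ∀ n, ∀ j ∉ s n, F n j = 0) (hn : Summable fun n => ∑ j ∈ s n, ‖F n j‖)
    (hu : ∀ n, ∑ j ∈ s n, F n j = u n) (hS : HasSum u S)
    (hg : ∀ j, HasSum (fun n => F n j) (g j)) : HasSum g S := by
  have h1 : ∀ n, HasSum (fun j => ‖F n j‖) (∑ j ∈ s n, ‖F n j‖) := fun n =>
    hasSum_sum_of_ne_finset_zero fun j hj => by rw [hF n j hj, norm_zero]
  have h2 : Summable fun p : ι × κ => F p.1 p.2 := by
    refine Summable.of_norm ((summable_prod_of_nonneg fun p => norm_nonneg _).mpr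
      ⟨fun n => (h1 n).summable, hn.congr fun n => (h1 n).tsum_eq.symm⟩)
  have h3 : HasSum u (∑' p : ι × κ, F p.1 p.2) := h2.hasSum.prod_fiberwise fun n => by
    rw [← hu n]
    exact hasSum_sum_of_ne_finset_zero (hF n)
  have h4 : HasSum (fun p : κ × ι => F p.2 p.1) S := by
    rw [← h3.unique hS]
    exact (Equiv.prodComm κ ι).hasSum_iff.mpr h2.hasSum
  exact h4.prod_fiberwise hg

variable {a b G : ℕ → ℝ}

/-- Summation by parts: `G n` is the sum of its increments up to `n`, and the terms carrying the
`j`-th increment form `x ^ j` times the series shifted by `j`. Nonnegative increments make the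
double series converge absolutely. -/
theorem hasSum_psFun_monotone_weight (ha : UnitSummable a) (hG : Monotone G) (hG0 : 0 ≤ G 0)
    (hGa : UnitSummable fun n => G n * a n) {x : ℂ} (hx : ‖x‖ < 1) :
    HasSum (fun j : ℕ => ((G j - if j = 0 then 0 else G (j - 1) : ℝ) : ℂ) * x ^ j *
      psFun (fun n => a (n + j)) x) (psFun (fun n => G n * a n) x) := by
  set δ : ℕ → ℝ := fun j => G j - if j = 0 then 0 else G (j - 1)
  have hδ : ∀ n, ∑ j ∈ Finset.range (n + 1), δ j = G n := by
    intro n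
    induction n with
    | zero => simp [δ]
    | succ n ih => rw [Finset.sum_range_succ, ih]; simp [δ]
  have hδ0 : ∀ j, 0 ≤ δ j := by
    intro j
    cases j with
    | zero => simpa [δ] using hG0
    | succ j => simpa [δ] using hG (Nat.le_succ j)
  refine hasSum_of_finite_inner
    (F := fun n j => if j ≤ n then (δ j : ℂ) * ((a n : ℂ) * x ^ n) else 0)
    (fun n => Finset.range (n + 1)) (fun n j h => if_neg (by simpa using h)) ?_ (fun n => ?_) (hGa.hasSum hx) fun j => ?_
  · refine (hGa.summable_norm hx).congr fun n => ?_
    have : ∀ j ∈ Finset.range (n + 1),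
        ‖if j ≤ n then (δ j : ℂ) * ((a n : ℂ) * x ^ n) else 0‖ = δ j * ‖(a n : ℂ) * x ^ n‖ := by
      intro j hj
      rw [if_pos (Nat.lt_succ_iff.mp (Finset.mem_range.mp hj)), norm_mul, Complex.norm_real,
        Real.norm_of_nonneg (hδ0 j)]
    rw [Finset.sum_congr rfl this, ← Finset.sum_mul, hδ, Complex.ofReal_mul, mul_assoc, norm_mul,
      Complex.norm_real, Real.norm_of_nonneg (hG0.trans (hG (Nat.zero_le n)))]
  · have : ∀ j ∈ Finset.range (n + 1),
        (if j ≤ n then (δ j : ℂ) * ((a n : ℂ) * x ^ n) else 0) = δ j * ((a n : ℂ) * x ^ n) := by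
      intro j hj
      rw [if_pos (Nat.lt_succ_iff.mp (Finset.mem_range.mp hj))]
    rw [Finset.sum_congr rfl this, ← Finset.sum_mul, ← Complex.ofReal_sum, hδ]
    push_cast
    ring
  · rw [← hasSum_nat_add_iff' j]
    rw [Finset.sum_eq_zero fun n hn => if_neg (not_le.mpr (Finset.mem_range.mp hn)), sub_zero]
    refine (((ha.shift_by j).hasSum hx).mul_left ((δ j : ℂ) * x ^ j)).congr_fun fun n => ?_
    rw [if_pos (Nat.le_add_left j n), pow_add]
    ring

/-- A sequence that is increasing up to the constant `C` is comparable to an increasing one. -/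
theorem exists_monotone_comparable {r : ℕ → ℝ} {C : ℝ} (h0 : ∀ n, 0 ≤ r n)
    (h : ∀ m n, m ≤ n → r m ≤ C * r n) :
    ∃ G : ℕ → ℝ, Monotone G ∧ 0 ≤ G 0 ∧ (∀ n, G n ≤ r n) ∧ ∀ n, r n ≤ C * G n := by
  have hb : ∀ n, BddBelow (Set.range fun k => r (n + k)) := fun n => ⟨0, by
    rintro _ ⟨k, rfl⟩
    exact h0 _⟩
  -- The infimum over the tail is increasing and lies below `r`; the hypothesis bounds `r n` by `C`
  -- times it.
  refine ⟨fun n => ⨅ k, r (n + k), monotone_nat_of_le_succ fun n => le_ciInf fun k => ?_,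
    le_ciInf fun k => h0 _, fun n => (ciInf_le (hb n) 0).trans_eq (by simp), fun n => ?_⟩
  · exact (ciInf_le (hb n) (k + 1)).trans_eq (by rw [add_assoc, add_comm 1 k])
  · rcases le_or_gt C 0 with hC | hC
    · have h1 : r n ≤ C * r n := h n n le_rfl
      have h2 : 0 ≤ ⨅ k, r (n + k) := le_ciInf fun k => h0 _
      have h3 : r n = 0 := by nlinarith [h0 n]
      have h4 : ⨅ k, r (n + k) = 0 :=
        le_antisymm ((ciInf_le (hb n) 0).trans_eq (by simpa using h3)) h2
      rw [h3]
      exact (mul_zero C ▸ congrArg (C * ·) h4).ge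
    · rw [← div_le_iff₀' hC]
      exact le_ciInf fun k => by
        rw [div_le_iff₀' hC]
        exact h _ _ (Nat.le_add_right n k)

variable {ι : Type*} [Fintype ι] [DecidableEq ι] {Φ : OpenUnitBall ℂ → Matrix ι ι ℂ} {C : ℝ}

/-- Each term of the summation by parts is a positive kernel times a shifted kernel, and shifts keep
the multiplier bound, so the constant `C` is retained. -/
theorem IsKernelMultiplier.monotone_weight (ha : UnitSummable a) (h0 : ∀ n, 0 ≤ a n)
    (hG : Monotone G) (hG0 : 0 ≤ G 0) (hGa : UnitSummable fun n => G n * a n)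
    (hΦ : ContinuousAt Φ discZero) (h : IsKernelMultiplier (psKernel ℂ a) Φ C) :
    IsKernelMultiplier (psKernel ℂ fun n => G n * a n) Φ C := by
  refine IsKernelMultiplier.of_hasSum (L := fun j z w =>
    ((G j - if j = 0 then 0 else G (j - 1) : ℝ) : ℂ) * pairing z w ^ j *
      psKernel ℂ (fun n => a (n + j)) z w) (fun j => ?_) fun z w =>
    hasSum_psFun_monotone_weight ha hG hG0 hGa (norm_pairing_lt_one z w)
  refine (h.shift_by ha h0 hΦ j).mul_posKernel
    (K' := fun z w => ((G j - if j = 0 then 0 else G (j - 1) : ℝ) : ℂ) * pairing z w ^ j) ?_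
  refine (posSemidef_pairing_pow (E := ℂ) j).smul
    (a := ((G j - if j = 0 then 0 else G (j - 1) : ℝ) : ℂ)) (Complex.zero_le_real.mpr ?_)
  cases j with
  | zero => simpa using hG0
  | succ j => simpa using hG (Nat.le_succ j)

/-- If the ratio of the coefficients `b` and `a` is increasing up to the constant `M`, then a
multiplier of the space with coefficients `a` is a multiplier of the one with coefficients `b`. -/
theorem IsKernelMultiplier.of_almost_monotone (ha : UnitSummable a) (hb : UnitSummable b)
    (ha0 : ∀ n, 0 < a n) (hb0 : ∀ n, 0 ≤ b n) {M : ℝ} (hM : 0 ≤ M) (hC : 0 ≤ C)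
    (hba : ∀ m n, m ≤ n → b m / a m ≤ M * (b n / a n)) (hΦ : ContinuousAt Φ discZero)
    (h : IsKernelMultiplier (psKernel ℂ a) Φ C) :
    IsKernelMultiplier (psKernel ℂ b) Φ (M * C) := by
  obtain ⟨G, hG, hG0, h1, h2⟩ :=
    exists_monotone_comparable (fun n => div_nonneg (hb0 n) (ha0 n).le) hba
  have hGn : ∀ n, 0 ≤ G n := fun n => hG0.trans (hG (Nat.zero_le n))
  have h3 : ∀ n, G n * a n ≤ b n := fun n => (le_div_iff₀ (ha0 n)).mp (h1 n)
  have h4 : ∀ n, b n ≤ M * (G n * a n) := fun n => by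
    rw [← mul_assoc]
    exact (div_le_iff₀ (ha0 n)).mp (h2 n)
  have hGa : UnitSummable fun n => G n * a n := hb.of_le (M := 1) fun n => by
    rw [abs_of_nonneg (mul_nonneg (hGn n) (ha0 n).le), abs_of_nonneg (hb0 n), one_mul]
    exact h3 n
  have h5 := (h.monotone_weight ha (fun n => (ha0 n).le) hG hG0 hGa hΦ).of_coeff_equivalent hGa hb
    one_pos hM hC (fun n => (one_mul _).trans_le (h3 n)) h4
  rwa [div_one] at h5

end MonotoneWeights

/-! ### Estimates for multinomial coefficients -/

section MultinomialEstimates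

open Finset

theorem Finset.prod_le_arith_mean_pow {ι : Type*} (s : Finset ι) (z : ι → ℝ)
    (hz : ∀ i ∈ s, 0 ≤ z i) : ∏ i ∈ s, z i ≤ ((∑ i ∈ s, z i) / #s) ^ #s := by
  rcases s.eq_empty_or_nonempty with rfl | hs
  · simp
  have hc : (0 : ℝ) < #s := by exact_mod_cast hs.card_pos
  have h := Real.geom_mean_le_arith_mean_weighted s (fun _ => ((#s : ℝ))⁻¹) z
    (fun _ _ => by positivity) (by simp [hc.ne']) hz
  have h1 : ∏ i ∈ s, z i = (∏ i ∈ s, z i ^ ((#s : ℝ))⁻¹) ^ #s := by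
    rw [← Finset.prod_pow]
    refine Finset.prod_congr rfl fun i hi => ?_
    rw [← Real.rpow_natCast, ← Real.rpow_mul (hz i hi), inv_mul_cancel₀ hc.ne', Real.rpow_one]
  rw [h1]
  refine pow_le_pow_left₀ (Finset.prod_nonneg fun i hi => Real.rpow_nonneg (hz i hi) _)
    (h.trans_eq ?_) _
  rw [← Finset.mul_sum, div_eq_inv_mul]

variable {d : ℕ}

/-- Quantifies the growth of `(1 + x / e) ^ e` in `e`, by Bernoulli's inequality for the ratio `t`
of the two bases. The sharper denominator `e + x` is weakened to `e + 1 + x`, the form needed for `d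
= e + 1`. -/
theorem one_add_pow_mul_le {e : ℕ} (he : 0 < e) {x : ℝ} (hx : 0 ≤ x) :
    (1 + x / e) ^ e * (1 + x ^ 2 / ((e + 1) ^ 2 * ((e + 1) + x))) ≤ (1 + x / (e + 1)) ^ (e + 1) := by
  have he' : (0 : ℝ) < e := by exact_mod_cast he
  set t : ℝ := (1 + x / (e + 1)) / (1 + x / e)
  have ht : t - 1 = - x / ((e + 1) * (e + x)) := by
    simp only [t]
    field_simp
    ring
  have h1 : 1 + e * (t - 1) ≤ t ^ e := by
    have := one_add_mul_le_pow (a := t - 1) (by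
      have : 0 ≤ t := by positivity
      linarith) e
    simpa using this
  have h2 : (1 + x / (e + 1)) * (1 + e * (t - 1)) = 1 + x ^ 2 / ((e + 1) ^ 2 * (e + x)) := by
    rw [ht]
    field_simp
    ring
  have h3 : x ^ 2 / ((e + 1) ^ 2 * ((e + 1) + x)) ≤ x ^ 2 / ((e + 1) ^ 2 * (e + x)) := by
    gcongr
    linarith
  have h4 : (1 + x / (e + 1)) ^ (e + 1) = (1 + x / e) ^ e * ((1 + x / (e + 1)) * t ^ e) := by
    have h5 : (1 + x / e) ^ e * t ^ e = (1 + x / (e + 1)) ^ e := by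
      rw [← mul_pow, mul_div_cancel₀ _ (by positivity)]
    rw [pow_succ, ← h5]
    ring
  rw [h4]
  refine mul_le_mul_of_nonneg_left ?_ (by positivity)
  calc 1 + x ^ 2 / ((e + 1) ^ 2 * ((e + 1) + x)) ≤ 1 + x ^ 2 / ((e + 1) ^ 2 * (e + x)) := by
        linarith
    _ = (1 + x / (e + 1)) * (1 + e * (t - 1)) := h2.symm
    _ ≤ (1 + x / (e + 1)) * t ^ e := by gcongr

/-- A quantitative arithmetic-geometric mean inequality when one of the numbers is minimal. -/
theorem prod_one_add_mul_le (y : Fin d → ℝ) (hy : ∀ i, 0 ≤ y i) {j : Fin d} (hj : y j = 0) :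
    (∏ i, (1 + y i)) * (1 + (∑ i, y i) ^ 2 / ((d : ℝ) ^ 2 * (d + ∑ i, y i))) ≤
      (1 + (∑ i, y i) / d) ^ d := by
  have hd : 0 < d := Nat.pos_of_ne_zero (by rintro rfl; exact j.elim0)
  -- The factor at `j` is `1`, so the mean inequality applies to the other `e` factors; passing from
  -- `e` to `e + 1` in `one_add_pow_mul_le` produces the gain.
  obtain ⟨e, rfl⟩ : ∃ e, d = e + 1 := ⟨d - 1, by omega⟩
  set x := ∑ i, y i
  have hx : 0 ≤ x := Finset.sum_nonneg fun i _ => hy i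
  have hs : ∑ i ∈ univ.erase j, y i = x := by
    have := Finset.add_sum_erase univ y (mem_univ j)
    rwa [hj, zero_add] at this
  have hp : ∏ i, (1 + y i) = ∏ i ∈ univ.erase j, (1 + y i) := by
    rw [← Finset.mul_prod_erase univ _ (mem_univ j), hj, add_zero, one_mul]
  have hc : #(univ.erase j) = e := by simp [card_erase_of_mem]
  rcases Nat.eq_zero_or_pos e with rfl | he
  · have hx0 : x = 0 := by
      rw [← hs, Finset.card_eq_zero.mp hc, Finset.sum_empty]
    rw [hp, Finset.card_eq_zero.mp hc, hx0]
    simp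
  · have h := Finset.prod_le_arith_mean_pow (univ.erase j) (fun i => 1 + y i)
      fun i _ => by linarith [hy i]
    rw [Finset.sum_add_distrib, hs, hc, Finset.sum_const, hc, nsmul_eq_mul, mul_one, add_div,
      div_self (by exact_mod_cast he.ne')] at h
    rw [hp]
    push_cast
    refine le_trans ?_ (one_add_pow_mul_le he hx)
    gcongr

/-- The multinomial coefficient of `β + (n, …, n)`, divided by the one of `(n, …, n)`. -/
noncomputable def multinomialRatio (β : Fin d → ℕ) (n : ℕ) : ℝ :=
  ((∑ i, β i + d * n).factorial * (n.factorial : ℝ) ^ d) /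
    ((d * n).factorial * ∏ i, ((β i + n).factorial : ℝ))

theorem multinomialRatio_pos (β : Fin d → ℕ) (n : ℕ) : 0 < multinomialRatio β n := by
  unfold multinomialRatio
  positivity

theorem factorial_add_eq_mul_prod (m d : ℕ) :
    ((m + d).factorial : ℝ) = m.factorial * ∏ j ∈ range d, ((m : ℝ) + j + 1) := by
  induction d with
  | zero => simp
  | succ d ih =>
    rw [Finset.prod_range_succ, ← mul_assoc, ← ih, ← add_assoc, Nat.factorial_succ]
    push_cast
    ring

/-- The quotient of consecutive values is `∏ l, (1 + k / (d n + l + 1))` divided by `∏ i, (1 + β i /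
(n + 1))`. As `l + 1 ≤ d`, the numerator is at least `(1 + k / (d (n + 1))) ^ d`, and
`prod_one_add_mul_le` compares this with the denominator. The vanishing entry of `β` supplies the
gain, which is quadratic in `k`. -/
theorem multinomialRatio_succ (β : Fin d → ℕ) {j : Fin d} (hj : β j = 0) (n : ℕ) :
    multinomialRatio β n * (1 + ((∑ i, β i : ℕ) : ℝ) ^ 2 /
      ((d : ℝ) ^ 2 * (n + 1) * (d * (n + 1) + (∑ i, β i : ℕ)))) ≤ multinomialRatio β (n + 1) := by
  have hd : (0 : ℝ) < d := by
    exact_mod_cast Nat.pos_of_ne_zero (by rintro rfl; exact j.elim0)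
  set k := ∑ i, β i with hk
  have hN : (0 : ℝ) < n + 1 := by positivity
  have h1 : ((k + d * (n + 1)).factorial : ℝ) =
      (k + d * n).factorial * ∏ l ∈ range d, ((k : ℝ) + d * n + l + 1) := by
    rw [mul_add, mul_one, ← add_assoc, factorial_add_eq_mul_prod]
    push_cast
    rfl
  have h2 : ((d * (n + 1)).factorial : ℝ) =
      (d * n).factorial * ∏ l ∈ range d, ((d : ℝ) * n + l + 1) := by
    rw [mul_add, mul_one, factorial_add_eq_mul_prod]
    push_cast
    rfl
  have h3 : ∏ i, ((β i + (n + 1)).factorial : ℝ) =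
      (∏ i, ((β i + n).factorial : ℝ)) * ∏ i, ((β i : ℝ) + n + 1) := by
    rw [← Finset.prod_mul_distrib]
    refine Finset.prod_congr rfl fun i _ => ?_
    rw [← add_assoc, Nat.factorial_succ]
    push_cast
    ring
  have h4 : (((n + 1).factorial : ℝ)) ^ d = (n.factorial : ℝ) ^ d * (n + 1) ^ d := by
    rw [Nat.factorial_succ, ← mul_pow]
    push_cast
    ring
  have h5 : multinomialRatio β (n + 1) = multinomialRatio β n *
      ((∏ l ∈ range d, ((k : ℝ) + d * n + l + 1)) / (∏ l ∈ range d, ((d : ℝ) * n + l + 1)) /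
        ((∏ i, ((β i : ℝ) + n + 1)) / (n + 1) ^ d)) := by
    rw [multinomialRatio, multinomialRatio, ← hk, h1, h2, h3, h4]
    have p1 : 0 < ∏ l ∈ range d, ((d : ℝ) * n + l + 1) := by positivity
    have p2 : 0 < ∏ i, ((β i : ℝ) + n + 1) := by positivity
    field_simp
  rw [h5]
  refine mul_le_mul_of_nonneg_left ?_ (multinomialRatio_pos β n).le
  have h6 : (∏ i, ((β i : ℝ) + n + 1)) / (n + 1) ^ d = ∏ i, (1 + (β i : ℝ) / (n + 1)) := by
    have : ((n : ℝ) + 1) ^ d = ∏ _i : Fin d, ((n : ℝ) + 1) := by simp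
    rw [this, ← Finset.prod_div_distrib]
    refine Finset.prod_congr rfl fun i _ => ?_
    field_simp
    ring
  have h7 : (1 + (k : ℝ) / (n + 1) / d) ^ d ≤
      (∏ l ∈ range d, ((k : ℝ) + d * n + l + 1)) / (∏ l ∈ range d, ((d : ℝ) * n + l + 1)) := by
    rw [← Finset.prod_div_distrib]
    have : (1 + (k : ℝ) / (n + 1) / d) ^ d = ∏ _l ∈ range d, (1 + (k : ℝ) / (n + 1) / d) := by simp
    rw [this]
    refine Finset.prod_le_prod (fun _ _ => by positivity) fun l hl => ?_
    have hl' : (l : ℝ) + 1 ≤ d := by exact_mod_cast Finset.mem_range.mp hl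
    have e : ((k : ℝ) + d * n + l + 1) / (d * n + l + 1) = 1 + k / (d * n + l + 1) := by
      field_simp
      ring
    rw [e, div_div]
    gcongr
    linarith
  have h8 := prod_one_add_mul_le (fun i => (β i : ℝ) / (n + 1)) (fun i => by positivity)
    (j := j) (by simp [hj])
  have h9 : ∑ i, (β i : ℝ) / (n + 1) = k / (n + 1) := by
    rw [← Finset.sum_div, hk]
    push_cast
    rfl
  rw [h9] at h8
  rw [h6, le_div_iff₀ (by positivity), mul_comm]
  refine le_trans ?_ (h8.trans h7)
  refine le_of_eq (congrArg _ (congrArg _ ?_))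
  field_simp

theorem exists_one_add_pow_le (S : ℕ) (D : ℝ) (hD : 0 ≤ D) :
    ∃ c : ℝ, 0 ≤ c ∧ ∀ u : ℝ, 0 ≤ u → u ≤ D → (1 + u) ^ S ≤ 1 + c * u := by
  induction S with
  | zero => exact ⟨0, le_rfl, fun u _ _ => by simp⟩
  | succ S ih =>
    obtain ⟨c, hc, h⟩ := ih
    refine ⟨1 + (1 + D) * c, by positivity, fun u h0 h1 => ?_⟩
    have h2 : c * (u * u) ≤ c * (D * u) := by gcongr
    calc (1 + u) ^ (S + 1) = (1 + u) ^ S * (1 + u) := pow_succ _ _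
      _ ≤ (1 + c * u) * (1 + u) := by gcongr; exact h u h0 h1
      _ ≤ 1 + (1 + (1 + D) * c) * u := by linarith

/-- The quotient `(|β| + d n + 1) / (d n + 1)`. -/
noncomputable def degreeRatio (d k n : ℕ) : ℝ := ((k : ℝ) + d * n + 1) / (d * n + 1)

theorem one_le_degreeRatio (d k n : ℕ) : 1 ≤ degreeRatio d k n := by
  rw [degreeRatio, one_le_div (by positivity)]
  linarith [Nat.cast_nonneg (α := ℝ) k]

theorem degreeRatio_le (d k n : ℕ) : degreeRatio d k n ≤ k + 1 := by
  rw [degreeRatio, div_le_iff₀ (by positivity)]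
  have : (0 : ℝ) ≤ k * (d * n) := by positivity
  linarith

theorem degreeRatio_antitone (d k : ℕ) : Antitone (degreeRatio d k) := by
  intro m n h
  have e : ∀ n : ℕ, degreeRatio d k n = 1 + k / (d * n + 1) := fun n => by
    rw [degreeRatio]
    field_simp
    ring
  rw [e, e]
  gcongr

/-- The exact quotient has denominator `(d n + 1) (k + d (n + 1) + 1)`. It is lowered so that the
excess over `1` is proportional to the gain in `multinomialRatio_succ`. -/
theorem degreeRatio_le_mul_succ (hd : 0 < d) (k n : ℕ) :
    degreeRatio d k n ≤ (1 + k * d / ((n + 1) * (d * (n + 1) + k))) * degreeRatio d k (n + 1) := by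
  have hd' : (1 : ℝ) ≤ d := by exact_mod_cast hd
  have e : degreeRatio d k n =
      (1 + (k : ℝ) * d / ((d * n + 1) * (k + d * (n + 1) + 1))) * degreeRatio d k (n + 1) := by
    rw [degreeRatio, degreeRatio]
    push_cast
    field_simp
    ring
  rw [e]
  have := one_le_degreeRatio d k (n + 1)
  refine mul_le_mul_of_nonneg_right ?_ (by linarith)
  have h1 : (n : ℝ) + 1 ≤ d * n + 1 := by nlinarith [Nat.cast_nonneg (α := ℝ) n]
  have h2 : (d : ℝ) * (n + 1) + k ≤ k + d * (n + 1) + 1 := by linarith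
  gcongr

theorem multinomialRatio_monotone (β : Fin d → ℕ) {j : Fin d} (hj : β j = 0) :
    Monotone (multinomialRatio β) := by
  refine monotone_nat_of_le_succ fun n => le_trans ?_ (multinomialRatio_succ β hj n)
  refine le_mul_of_one_le_right (multinomialRatio_pos β n).le ?_
  have : (0 : ℝ) ≤ ((∑ i, β i : ℕ) : ℝ) ^ 2 /
      ((d : ℝ) ^ 2 * (n + 1) * (d * (n + 1) + (∑ i, β i : ℕ))) := by positivity
  linarith

/-- In one step the degree quotient loses at most a factor `1 + u`, so its power loses at most `1 +
c u`, while the multinomial quotient gains at least `1 + (k / d ^ 3) u`. For `k ≥ d ^ 3 c` the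
product is therefore increasing. For smaller `k` the degree quotient lies between `1` and `d ^ 3 c +
1`, and monotonicity of the multinomial quotient suffices. -/
theorem exists_almost_monotone_pow (d S : ℕ) : ∃ M : ℝ, 0 < M ∧ ∀ β : Fin d → ℕ,
    (∃ j, β j = 0) → ∀ m n, m ≤ n →
      multinomialRatio β m * degreeRatio d (∑ i, β i) m ^ S ≤
        M * (multinomialRatio β n * degreeRatio d (∑ i, β i) n ^ S) := by
  obtain ⟨c, hc, hcu⟩ := exists_one_add_pow_le S d (Nat.cast_nonneg d)
  refine ⟨((d : ℝ) ^ 3 * c + 1) ^ S, by positivity, ?_⟩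
  rintro β ⟨j, hj⟩ m n hmn
  have hd : 0 < d := Nat.pos_of_ne_zero (by rintro rfl; exact j.elim0)
  have hd' : (0 : ℝ) < d := by exact_mod_cast hd
  have hR := multinomialRatio_pos β
  set k := ∑ i, β i with hk
  have hQ : ∀ n, 1 ≤ degreeRatio d k n := one_le_degreeRatio d k
  have hQ0 : ∀ n, 0 ≤ degreeRatio d k n := fun n => zero_le_one.trans (hQ n)
  rcases le_or_gt ((d : ℝ) ^ 3 * c) k with h | h
  · have hm : Monotone fun n => multinomialRatio β n * degreeRatio d k n ^ S := by
      refine monotone_nat_of_le_succ fun n => ?_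
      set u : ℝ := k * d / ((n + 1) * (d * (n + 1) + k)) with hu
      have hu0 : 0 ≤ u := by positivity
      have hud : u ≤ d := by
        rw [hu, div_le_iff₀ (by positivity), mul_comm]
        gcongr
        have : (0 : ℝ) ≤ n * (d * (n + 1) + k) + d * (n + 1) := by positivity
        linarith
      have h1 := multinomialRatio_succ β hj n
      have h2 : ((k : ℝ)) ^ 2 / ((d : ℝ) ^ 2 * (n + 1) * (d * (n + 1) + k)) = k / d ^ 3 * u := by
        rw [hu]
        field_simp
      rw [← hk, h2] at h1
      have h3 : c * u ≤ k / d ^ 3 * u := by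
        refine mul_le_mul_of_nonneg_right ?_ hu0
        rw [le_div_iff₀ (by positivity), mul_comm]
        exact h
      calc multinomialRatio β n * degreeRatio d k n ^ S
          ≤ multinomialRatio β n * ((1 + u) * degreeRatio d k (n + 1)) ^ S := by
            have := degreeRatio_le_mul_succ hd k n
            have h5 := hR n
            have h6 := hQ0 n
            gcongr
        _ = multinomialRatio β n * (1 + u) ^ S * degreeRatio d k (n + 1) ^ S := by
            rw [mul_pow, mul_assoc]
        _ ≤ multinomialRatio β n * (1 + k / d ^ 3 * u) * degreeRatio d k (n + 1) ^ S := by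
            refine mul_le_mul_of_nonneg_right (mul_le_mul_of_nonneg_left ?_ (hR n).le)
              (pow_nonneg (hQ0 _) _)
            exact (hcu u hu0 hud).trans (by linarith)
        _ ≤ multinomialRatio β (n + 1) * degreeRatio d k (n + 1) ^ S :=
            mul_le_mul_of_nonneg_right h1 (pow_nonneg (hQ0 _) _)
    refine (hm hmn).trans (le_mul_of_one_le_left ?_ ?_)
    · exact mul_nonneg (hR n).le (pow_nonneg (hQ0 n) _)
    · refine one_le_pow₀ ?_
      have : 0 ≤ (d : ℝ) ^ 3 * c := by positivity
      linarith
  · calc multinomialRatio β m * degreeRatio d k m ^ S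
        ≤ multinomialRatio β n * ((d : ℝ) ^ 3 * c + 1) ^ S := by
          have h1 := multinomialRatio_monotone β hj hmn
          have h2 : degreeRatio d k m ≤ (d : ℝ) ^ 3 * c + 1 := (degreeRatio_le d k m).trans (by linarith)
          have h3 := hQ0 m
          have h4 := (hR n).le
          gcongr
      _ = ((d : ℝ) ^ 3 * c + 1) ^ S * (multinomialRatio β n * 1) := by ring
      _ ≤ _ := by
          refine mul_le_mul_of_nonneg_left (mul_le_mul_of_nonneg_left ?_ (hR n).le) (by positivity)
          exact one_le_pow₀ (hQ n)

/-- With a natural number `S ≥ s`, the remaining factor has exponent `s - S ≤ 0` on a decreasing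
base, so it increases. -/
theorem exists_almost_monotone_rpow (d : ℕ) (s : ℝ) : ∃ M : ℝ, 0 < M ∧ ∀ β : Fin d → ℕ,
    (∃ j, β j = 0) → ∀ m n, m ≤ n →
      multinomialRatio β m * degreeRatio d (∑ i, β i) m ^ s ≤
        M * (multinomialRatio β n * degreeRatio d (∑ i, β i) n ^ s) := by
  obtain ⟨S, hS⟩ := exists_nat_ge s
  obtain ⟨M, hM, h⟩ := exists_almost_monotone_pow d S
  refine ⟨M, hM, fun β hβ m n hmn => ?_⟩
  set k := ∑ i, β i
  have hQ : ∀ n, 0 < degreeRatio d k n := fun n => zero_lt_one.trans_le (one_le_degreeRatio d k n)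
  have e : ∀ n, degreeRatio d k n ^ s = degreeRatio d k n ^ S * degreeRatio d k n ^ (s - S) := by
    intro n
    rw [← Real.rpow_natCast, ← Real.rpow_add (hQ n)]
    ring_nf
  have h1 : degreeRatio d k m ^ (s - S) ≤ degreeRatio d k n ^ (s - S) :=
    Real.rpow_le_rpow_of_nonpos (hQ n) (degreeRatio_antitone d k hmn) (by linarith)
  rw [e, e, ← mul_assoc, ← mul_assoc (multinomialRatio β n), ← mul_assoc M]
  have h2 := multinomialRatio_pos β n
  have h3 := hQ n
  have h4 := hQ m
  exact mul_le_mul (h β hβ m n hmn) h1 (by positivity) (by positivity)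

end MultinomialEstimates

/-! ### Orders of magnitude of the coefficients -/

section Comparable

open Filter Topology

/-- The sequences `f` and `g` are bounded by positive multiples of each other. -/
def IsComparable (f g : ℕ → ℝ) : Prop :=
  ∃ m M : ℝ, 0 < m ∧ 0 < M ∧ ∀ n, m * g n ≤ f n ∧ f n ≤ M * g n

theorem IsComparable.of_tendsto {f g : ℕ → ℝ} (hf : ∀ n, 0 < f n) (hg : ∀ n, 0 < g n) {L : ℝ}
    (hL : 0 < L) (h : Tendsto (fun n => f n / g n) atTop (𝓝 L)) : IsComparable f g := by
  obtain ⟨M, hM⟩ := h.bddAbove_range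
  obtain ⟨m, hm⟩ := (h.inv₀ hL.ne').bddAbove_range
  have hM' : ∀ n, f n / g n ≤ M := fun n => hM ⟨n, rfl⟩
  have hm' : ∀ n, (f n / g n)⁻¹ ≤ m := fun n => hm ⟨n, rfl⟩
  have hM0 : 0 < M := (div_pos (hf 0) (hg 0)).trans_le (hM' 0)
  have hm0 : 0 < m := (inv_pos.mpr (div_pos (hf 0) (hg 0))).trans_le (hm' 0)
  refine ⟨m⁻¹, M, inv_pos.mpr hm0, hM0, fun n => ⟨?_, (div_le_iff₀ (hg n)).mp (hM' n)⟩⟩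
  rw [← le_div_iff₀ (hg n)]
  exact inv_le_of_inv_le₀ (div_pos (hf n) (hg n)) (hm' n)

theorem IsComparable.refl (f : ℕ → ℝ) : IsComparable f f :=
  ⟨1, 1, one_pos, one_pos, fun n => by simp⟩

theorem tendsto_natCast_div_add_one :
    Tendsto (fun n : ℕ => (n : ℝ) / (n + 1)) atTop (𝓝 1) :=
  tendsto_natCast_div_add_atTop 1

/-- The central multinomial coefficients have the order of magnitude `d ^ (d n) n ^ (-(d - 1) / 2)`. -/
theorem isComparable_central_multinomial (d : ℕ) (hd : 0 < d) :
    IsComparable (fun n => ((d * n).factorial : ℝ) / ((n.factorial : ℝ) ^ d * (d : ℝ) ^ (d * n)))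
      (fun n => ((n : ℝ) + 1) ^ (-(((d : ℝ) - 1) / 2))) := by
  have hd' : (0 : ℝ) < d := by exact_mod_cast hd
  have hσ := Stirling.tendsto_stirlingSeq_sqrt_pi
  have hdn : Tendsto (fun n : ℕ => d * n) atTop atTop :=
    tendsto_id.const_mul_atTop' hd
  have h1 : Tendsto (fun n : ℕ => √(((n : ℝ) + 1) / (2 * n))) atTop (𝓝 (√(1 / 2))) := by
    refine (Real.continuous_sqrt.tendsto _).comp ?_
    have := (tendsto_natCast_div_add_one.const_mul 2).inv₀ (by norm_num)
    simp only [mul_one] at this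
    rw [one_div]
    refine this.congr fun n => ?_
    rw [← mul_div_assoc, inv_div]
  -- Stirling's formula for `(d n)!` and for the `d` factors `n!`: the exponential parts cancel
  -- against `d ^ (d n)`, the square roots leave `√d / √(2 n) ^ (d - 1)`, and `h1` turns `2 n` into
  -- `n + 1`.
  have h2 := (((hσ.comp hdn).div (hσ.pow d) (by positivity)).mul_const (√d)).mul (h1.pow (d - 1))
  refine IsComparable.of_tendsto (fun n => by positivity) (fun n => by positivity)
    (L := √Real.pi / √Real.pi ^ d * √d * √(1 / 2) ^ (d - 1)) (by positivity) (h2.congr' ?_)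
  filter_upwards [eventually_gt_atTop 0] with n hn
  have hn' : (0 : ℝ) < n := by exact_mod_cast hn
  have hexp : (((n : ℝ) + 1) ^ (-(((d : ℝ) - 1) / 2))) = (√((n : ℝ) + 1) ^ (d - 1))⁻¹ := by
    rw [Real.rpow_neg (by positivity), Real.sqrt_eq_rpow, ← Real.rpow_natCast, ← Real.rpow_mul
      (by positivity), Nat.cast_sub hd]
    congr 2
    push_cast
    ring
  have hs : √(2 * (n : ℝ)) ^ d = √(2 * (n : ℝ)) ^ (d - 1) * √(2 * (n : ℝ)) := by
    rw [← pow_succ, Nat.sub_add_cancel hd]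
  have hs2 : √(2 * ((d : ℝ) * n)) = √d * √(2 * (n : ℝ)) := by
    rw [← Real.sqrt_mul hd'.le]
    ring_nf
  have hp : (((d : ℝ) * n) / Real.exp 1) ^ (d * n) = d ^ (d * n) * ((n / Real.exp 1) ^ n) ^ d := by
    rw [← pow_mul, mul_comm n d, ← mul_pow, mul_div_assoc]
  have p1 : 0 < √(2 * (n : ℝ)) := by positivity
  simp only [Pi.div_apply, Function.comp_apply, Stirling.stirlingSeq]
  rw [hexp, Real.sqrt_div (by positivity)]
  push_cast
  rw [hs2, hp]
  simp only [div_pow, mul_pow]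
  rw [hs]
  field_simp

theorem multichoose_eq_prod (a : ℝ) (n : ℕ) :
    Ring.multichoose a n = (∏ j ∈ Finset.range n, (a + j)) / n.factorial := by
  have h := Ring.factorial_nsmul_multichoose_eq_ascPochhammer a n
  rw [Polynomial.ascPochhammer_smeval_eq_eval, nsmul_eq_mul] at h
  rw [eq_div_iff (by positivity), mul_comm, h]
  clear h
  induction n with
  | zero => simp
  | succ n ih => rw [ascPochhammer_succ_eval, Finset.prod_range_succ, ih]

/-- Euler's limit formula for the Gamma function: the quotient tends to `1 / Γ(a)`. -/
theorem isComparable_multichoose {a : ℝ} (ha : 0 < a) :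
    IsComparable (fun n => Ring.multichoose a n) (fun n => ((n : ℝ) + 1) ^ (a - 1)) := by
  have hpos : ∀ n, 0 < Ring.multichoose a n := fun n => by
    rw [multichoose_eq_prod]
    positivity
  refine IsComparable.of_tendsto hpos (fun n => by positivity)
    (inv_pos.mpr (Real.Gamma_pos_of_pos ha)) ?_
  have h1 := (Real.GammaSeq_tendsto_Gamma a).inv₀ (Real.Gamma_pos_of_pos ha).ne'
  have h2 : Tendsto (fun n : ℕ => ((n : ℝ) / (n + 1)) ^ (a - 1)) atTop (𝓝 1) := by
    simpa using tendsto_natCast_div_add_one.rpow_const (p := a - 1) (Or.inl one_ne_zero)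
  have h3 : Tendsto (fun n : ℕ => (n : ℝ) / (n + a)) atTop (𝓝 1) := tendsto_natCast_div_add_atTop a
  have h := (h1.mul h2).mul h3
  rw [mul_one, mul_one] at h
  refine h.congr' ?_
  filter_upwards [eventually_gt_atTop 0] with n hn
  have hn' : (0 : ℝ) < n := by exact_mod_cast hn
  have hp : 0 < ∏ j ∈ Finset.range n, (a + j) := by positivity
  rw [multichoose_eq_prod, Real.GammaSeq, Finset.prod_range_succ, Real.div_rpow hn'.le
    (by positivity), show (n : ℝ) ^ a = n ^ (a - 1) * n by
      rw [← Real.rpow_add_one hn'.ne', sub_add_cancel]]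
  field_simp
  ring

/-- The order of magnitude makes `𝒟_a` behave like `ℋ_s` with `s = a - 1`, including `a = 0`. -/
theorem exists_coeff_dirichletFun (a : ℝ≥0) : ∃ c : ℕ → ℝ, (∀ n, 0 < c n) ∧
    (∀ x : ℂ, ‖x‖ < 1 → HasSum (fun n => (c n : ℂ) * x ^ n) (dirichletFun a x)) ∧
    IsComparable c (fun n => ((n : ℝ) + 1) ^ ((a : ℝ) - 1)) := by
  rcases eq_or_ne a 0 with rfl | ha
  · refine ⟨fun n => ((n : ℝ) + 1)⁻¹, fun n => by positivity, fun x hx => ?_, ?_⟩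
    · rcases eq_or_ne x 0 with rfl | h0
      · have h := hasSum_ite_eq (0 : ℕ) (1 : ℂ)
        simp only [dirichletFun, if_true]
        refine h.congr_fun fun n => ?_
        rcases eq_or_ne n 0 with rfl | hn
        · simp
        · simp [hn]
      · have h := (Complex.hasSum_taylorSeries_neg_log' hx).mul_left (1 / x)
        have hl : Complex.log (1 / (1 - x)) = -Complex.log (1 - x) := by
          rw [one_div, Complex.log_inv]
          intro harg
          have hs := Complex.mem_slitPlane_of_norm_lt_one (z := -x) (by simpa using hx)
          rw [← sub_eq_add_neg] at hs
          exact (Complex.mem_slitPlane_iff_arg.mp hs).1 harg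
        simp only [dirichletFun, if_true, if_neg h0, hl]
        refine h.congr_fun fun n => ?_
        push_cast
        field_simp
        ring
    · convert IsComparable.refl _ using 1
      ext n
      rw [NNReal.coe_zero, zero_sub, Real.rpow_neg_one]
  · have ha' : (0 : ℝ) < a := by exact_mod_cast pos_iff_ne_zero.mpr ha
    refine ⟨fun n => Ring.multichoose (a : ℝ) n, fun n => ?_, fun x hx => ?_,
      isComparable_multichoose ha'⟩
    · simp only [multichoose_eq_prod]
      positivity
    · have h := (Complex.one_div_one_sub_cpow_hasFPowerSeriesOnBall_zero
        ((a : ℝ) : ℂ)).hasSum (y := x) (by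
          rw [← ENNReal.ofReal_one, Metric.eball_ofReal]
          exact mem_ball_zero_iff.mpr hx)
      simp only [dirichletFun, if_neg ha]
      rw [zero_add] at h
      refine h.congr_fun fun n => ?_
      have hm := Ring.map_multichoose Complex.ofRealHom (a : ℝ) n
      rw [Complex.ofRealHom_eq_coe, Complex.ofRealHom_eq_coe] at hm
      rw [hm]
      simp [FormalMultilinearSeries.ofScalars, Ring.multichoose_eq]

variable {d : ℕ}

/-- The coefficient at `β + (n, …, n)` of the kernel `∑ n, c n * ⟨z, w⟩ ^ n` on the unit ball of
`ℂ ^ d`, normalized with respect to the powers of `τ`. -/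
noncomputable def ballCoeff (c : ℕ → ℝ) (β : Fin d → ℕ) (n : ℕ) : ℝ :=
  c (∑ i, β i + d * n) * ((∑ i, β i + d * n).factorial / ∏ i, ((β i + n).factorial : ℝ)) /
    (d : ℝ) ^ (d * n)

theorem ballCoeff_pos (hd : 0 < d) {c : ℕ → ℝ} (hc : ∀ n, 0 < c n) (β : Fin d → ℕ) (n : ℕ) :
    0 < ballCoeff c β n := by
  have := hc (∑ i, β i + d * n)
  have hd' : (0 : ℝ) < d := by exact_mod_cast hd
  unfold ballCoeff
  positivity

/-- Up to constants that do not depend on `β`, the quotient `ballCoeff c β n / a n` is the product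
of the quotient of multinomial coefficients and of the power `s` of the quotient of degrees. -/
theorem exists_ballCoeff_bounds (hd : 0 < d) {s : ℝ} {a c : ℕ → ℝ}
    (hc : IsComparable c fun n => ((n : ℝ) + 1) ^ s)
    (ha : IsComparable a fun n => ((n : ℝ) + 1) ^ (s - ((d : ℝ) - 1) / 2))
    (ha0 : ∀ n, 0 < a n) :
    ∃ m M : ℝ, 0 < m ∧ 0 < M ∧ ∀ (β : Fin d → ℕ) (n : ℕ),
      m * (multinomialRatio β n * degreeRatio d (∑ i, β i) n ^ s) ≤ ballCoeff c β n / a n ∧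
      ballCoeff c β n / a n ≤ M * (multinomialRatio β n * degreeRatio d (∑ i, β i) n ^ s) := by
  obtain ⟨m₁, M₁, hm₁, hM₁, h₁⟩ := hc
  obtain ⟨m₂, M₂, hm₂, hM₂, h₂⟩ := ha
  obtain ⟨m₃, M₃, hm₃, hM₃, h₃⟩ := isComparable_central_multinomial d hd
  have hd' : (1 : ℝ) ≤ d := by exact_mod_cast hd
  -- comparison of `(d n + 1) ^ s` with `(n + 1) ^ s`
  obtain ⟨m₄, M₄, hm₄, hM₄, h₄⟩ : ∃ m M : ℝ, 0 < m ∧ 0 < M ∧ ∀ n : ℕ,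
      m * ((n : ℝ) + 1) ^ s ≤ ((d : ℝ) * n + 1) ^ s ∧
        ((d : ℝ) * n + 1) ^ s ≤ M * ((n : ℝ) + 1) ^ s := by
    have l1 : ∀ n : ℕ, (n : ℝ) + 1 ≤ d * n + 1 := fun n => by
      nlinarith [Nat.cast_nonneg (α := ℝ) n]
    have l2 : ∀ n : ℕ, (d : ℝ) * n + 1 ≤ d * (n + 1) := fun n => by linarith
    rcases le_total 0 s with hs | hs
    · refine ⟨1, (d : ℝ) ^ s, one_pos, by positivity, fun n => ⟨?_, ?_⟩⟩
      · rw [one_mul]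
        exact Real.rpow_le_rpow (by positivity) (l1 n) hs
      · rw [← Real.mul_rpow (by positivity) (by positivity)]
        exact Real.rpow_le_rpow (by positivity) (l2 n) hs
    · refine ⟨(d : ℝ) ^ s, 1, by positivity, one_pos, fun n => ⟨?_, ?_⟩⟩
      · rw [← Real.mul_rpow (by positivity) (by positivity)]
        exact Real.rpow_le_rpow_of_nonpos (by positivity) (l2 n) hs
      · rw [one_mul]
        exact Real.rpow_le_rpow_of_nonpos (by positivity) (l1 n) hs
  refine ⟨m₁ * m₃ * m₄ / M₂, M₁ * M₃ * M₄ / m₂, by positivity, by positivity, fun β n => ?_⟩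
  set k := ∑ i, β i with hk
  set R := multinomialRatio β n
  have hR : 0 < R := multinomialRatio_pos β n
  set Q : ℝ := ((k : ℝ) + d * n + 1) ^ s
  have hQ : 0 < Q := by positivity
  set D : ℝ := ((d : ℝ) * n + 1) ^ s
  have hD : 0 < D := by positivity
  have hQD : degreeRatio d k n ^ s = Q / D := Real.div_rpow (by positivity) (by positivity) s
  set T : ℝ := ((d * n).factorial : ℝ) / ((n.factorial : ℝ) ^ d * (d : ℝ) ^ (d * n))
  have hT : 0 < T := by positivity
  set P : ℝ := ((n : ℝ) + 1) ^ s
  have hP : 0 < P := by positivity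
  set V : ℝ := ((n : ℝ) + 1) ^ (-(((d : ℝ) - 1) / 2))
  have hV : 0 < V := by positivity
  have hPV : ((n : ℝ) + 1) ^ (s - ((d : ℝ) - 1) / 2) = P * V := by
    rw [sub_eq_add_neg, Real.rpow_add (by positivity)]
  -- The multinomial coefficient splits into its quotient `R` by the central one and the normalized
  -- central one `T`, which has the size of `V` uniformly in `β`.
  have hb : ballCoeff c β n = c (k + d * n) * (R * T) := by
    simp only [ballCoeff, R, T, multinomialRatio, ← hk]
    field_simp
  have b1 := h₁ (k + d * n)
  push_cast at b1
  have b2 := h₂ n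
  simp only [hPV] at b2
  have b3 := h₃ n
  have b4 := h₄ n
  have hc0 : 0 < c (k + d * n) := lt_of_lt_of_le (by positivity) b1.1
  have han := ha0 n
  rw [hb, hQD]
  constructor
  · rw [le_div_iff₀ han]
    calc m₁ * m₃ * m₄ / M₂ * (R * (Q / D)) * a n
        ≤ m₁ * m₃ * m₄ / M₂ * (R * (Q / D)) * (M₂ * (P * V)) := by gcongr; exact b2.2
      _ = (m₁ * Q) * (R * (m₃ * V)) * ((m₄ * P) / D) := by field_simp
      _ ≤ c (k + d * n) * (R * T) * (D / D) := by
          gcongr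
          exacts [b1.1, b3.1, b4.1]
      _ = c (k + d * n) * (R * T) := by rw [div_self hD.ne', mul_one]
  · rw [div_le_iff₀ han]
    calc c (k + d * n) * (R * T) = c (k + d * n) * (R * T) * (D / D) := by
          rw [div_self hD.ne', mul_one]
      _ ≤ (M₁ * Q) * (R * (M₃ * V)) * ((M₄ * P) / D) := by
          gcongr
          exacts [b1.2, b3.2, b4.2]
      _ = M₁ * M₃ * M₄ / m₂ * (R * (Q / D)) * (m₂ * (P * V)) := by field_simp
      _ ≤ M₁ * M₃ * M₄ / m₂ * (R * (Q / D)) * a n := by gcongr; exact b2.1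

/-- The coefficients `ballCoeff c β` are increasing relative to `a`, up to a constant that does not
depend on `β`. -/
theorem exists_ballCoeff_almost_monotone (hd : 0 < d) {s : ℝ} {a c : ℕ → ℝ}
    (hc : IsComparable c fun n => ((n : ℝ) + 1) ^ s)
    (ha : IsComparable a fun n => ((n : ℝ) + 1) ^ (s - ((d : ℝ) - 1) / 2))
    (ha0 : ∀ n, 0 < a n) :
    ∃ M : ℝ, 0 < M ∧ ∀ β : Fin d → ℕ, (∃ j, β j = 0) → ∀ m n, m ≤ n →
      ballCoeff c β m / a m ≤ M * (ballCoeff c β n / a n) := by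
  obtain ⟨m₁, M₁, hm₁, hM₁, h₁⟩ := exists_ballCoeff_bounds hd hc ha ha0
  obtain ⟨M, hM, h⟩ := exists_almost_monotone_rpow d s
  refine ⟨M₁ * M / m₁, by positivity, fun β hβ m n hmn => ?_⟩
  calc ballCoeff c β m / a m
      ≤ M₁ * (multinomialRatio β m * degreeRatio d (∑ i, β i) m ^ s) := (h₁ β m).2
    _ ≤ M₁ * (M * (multinomialRatio β n * degreeRatio d (∑ i, β i) n ^ s)) := by
        exact mul_le_mul_of_nonneg_left (h β hβ m n hmn) hM₁.le
    _ = M₁ * M / m₁ * (m₁ * (multinomialRatio β n * degreeRatio d (∑ i, β i) n ^ s)) := by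
        field_simp
    _ ≤ M₁ * M / m₁ * (ballCoeff c β n / a n) := by
        gcongr
        exact (h₁ β n).1

theorem isComparable_ballCoeff_zero (hd : 0 < d) {s : ℝ} {a c : ℕ → ℝ}
    (hc : IsComparable c fun n => ((n : ℝ) + 1) ^ s)
    (ha : IsComparable a fun n => ((n : ℝ) + 1) ^ (s - ((d : ℝ) - 1) / 2))
    (ha0 : ∀ n, 0 < a n) : IsComparable (ballCoeff c (0 : Fin d → ℕ)) a := by
  obtain ⟨m, M, hm, hM, h⟩ := exists_ballCoeff_bounds hd hc ha ha0
  refine ⟨m, M, hm, hM, fun n => ?_⟩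
  have h1 := h 0 n
  have e1 : multinomialRatio (0 : Fin d → ℕ) n = 1 := by
    have : (0 : ℝ) < n.factorial := by positivity
    simp only [multinomialRatio, Pi.zero_apply, Finset.sum_const_zero, zero_add, Finset.prod_const,
      Finset.card_univ, Fintype.card_fin]
    field_simp
  have e2 : degreeRatio d (∑ i : Fin d, (0 : Fin d → ℕ) i) n = 1 := by
    simp only [degreeRatio, Pi.zero_apply, Finset.sum_const_zero, Nat.cast_zero, zero_add]
    exact div_self (by positivity)
  rw [e1, e2, Real.one_rpow, mul_one, mul_one, mul_one, le_div_iff₀ (ha0 n),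
    div_le_iff₀ (ha0 n)] at h1
  exact h1

end Comparable

/-! ### The monomial expansion of kernels on the ball -/

section MonomialExpansion

open Finset

variable {d : ℕ} {c : ℕ → ℝ}

/-- Multinomial theorem in each degree. The hypothesis bounds the sum of the norms, not just the
norm of the sum, so that the series over multi-indices converges absolutely. -/
theorem hasSum_multinomial (hc : UnitSummable c) {x : Fin d → ℂ} (hx : ∑ i, ‖x i‖ < 1) :
    HasSum (fun α : Fin d → ℕ =>
      (c (∑ i, α i) : ℂ) * (Nat.multinomial univ α * ∏ i, x i ^ α i)) (psFun c (∑ i, x i)) := by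
  have hx' : ‖∑ i, x i‖ < 1 := (norm_sum_le _ _).trans_lt hx
  refine hasSum_of_finite_inner (F := fun n α => if ∑ i, α i = n then
    (c (∑ i, α i) : ℂ) * (Nat.multinomial univ α * ∏ i, x i ^ α i) else 0)
    (fun n => piAntidiag univ n) (fun n α hα => if_neg fun h => hα (by simp [h])) ?_
    (fun n => ?_) (hc.hasSum hx') fun α => ?_
  · refine (hc (∑ i, ‖x i‖) (Finset.sum_nonneg fun i _ => norm_nonneg _) hx).congr fun n => ?_
    rw [sum_pow_eq_sum_piAntidiag, Finset.mul_sum]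
    refine Finset.sum_congr rfl fun α hα => ?_
    have h : ∑ i, α i = n := by simpa using hα
    rw [if_pos h, h]
    simp [norm_prod, norm_pow]
  · rw [sum_pow_eq_sum_piAntidiag, Finset.mul_sum]
    refine Finset.sum_congr rfl fun α hα => ?_
    have h : ∑ i, α i = n := by simpa using hα
    rw [if_pos h, h]
  · convert hasSum_ite_eq (∑ i, α i)
      ((c (∑ i, α i) : ℂ) * (Nat.multinomial univ α * ∏ i, x i ^ α i)) using 3
    exact eq_comm

/-- Every multi-index is uniquely of the form `β + (n, …, n)` where `β` has a vanishing entry. -/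
noncomputable def multiIndexEquiv (d : ℕ) [NeZero d] :
    {β : Fin d → ℕ // ∃ j, β j = 0} × ℕ ≃ (Fin d → ℕ) :=
  Equiv.ofBijective (fun p i => p.1.1 i + p.2) <| by
    constructor
    · rintro ⟨⟨β, j, hj⟩, n⟩ ⟨⟨β', j', hj'⟩, n'⟩ h
      have h1 : ∀ i, β i + n = β' i + n' := fun i => congrFun h i
      have h2 := h1 j
      have h3 := h1 j'
      obtain rfl : n = n' := by omega
      have : β = β' := funext fun i => by have := h1 i; omega
      subst this
      rfl
    · intro α
      obtain ⟨j, -, hj⟩ := Finset.exists_min_image univ α ⟨⟨0, Nat.pos_of_ne_zero (NeZero.ne d)⟩,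
        mem_univ _⟩
      refine ⟨⟨⟨fun i => α i - α j, j, Nat.sub_self _⟩, α j⟩, funext fun i => ?_⟩
      exact Nat.sub_add_cancel (hj i (mem_univ i))

theorem multinomial_term_eq [NeZero d] (β : Fin d → ℕ) (n : ℕ) (x : Fin d → ℂ) :
    (c (∑ i, (β i + n)) : ℂ) * (Nat.multinomial univ (fun i => β i + n) * ∏ i, x i ^ (β i + n)) =
      (∏ i, x i ^ β i) * ((ballCoeff c β n : ℂ) * ((d : ℂ) ^ d * ∏ i, x i) ^ n) := by
  have hs : ∑ i, (β i + n) = ∑ i, β i + d * n := by simp [Finset.sum_add_distrib]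
  have hd : (d : ℂ) ≠ 0 := by exact_mod_cast NeZero.ne d
  have hm : (Nat.multinomial univ (fun i => β i + n) : ℂ) =
      (∑ i, β i + d * n).factorial / ∏ i, ((β i + n).factorial : ℂ) := by
    rw [eq_div_iff (Finset.prod_ne_zero_iff.mpr fun i _ => by exact_mod_cast Nat.factorial_ne_zero _),
      mul_comm]
    have := Nat.multinomial_spec univ (fun i => β i + n)
    rw [hs] at this
    exact_mod_cast this
  rw [hs, hm, ballCoeff, mul_pow, ← pow_mul]
  simp only [pow_add, Finset.prod_mul_distrib, Finset.prod_pow]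
  push_cast
  field_simp

theorem hasSum_multinomial_fibers [NeZero d] (hc : UnitSummable c) {x : Fin d → ℂ}
    (hx : ∑ i, ‖x i‖ < 1) :
    HasSum (fun p : {β : Fin d → ℕ // ∃ j, β j = 0} × ℕ =>
      (∏ i, x i ^ p.1.1 i) * ((ballCoeff c p.1.1 p.2 : ℂ) * ((d : ℂ) ^ d * ∏ i, x i) ^ p.2))
      (psFun c (∑ i, x i)) := by
  refine ((multiIndexEquiv d).hasSum_iff.mpr (hasSum_multinomial hc hx)).congr_fun fun p => ?_
  exact (multinomial_term_eq p.1.1 p.2 x).symm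

/-- The multi-index series is evaluated at `x i = y / d` with `y ^ d = r`: then `∑ ‖x i‖ = y < 1`
and `d ^ d ∏ x i = r`, so the fiber over `β` is a nonzero multiple of the series in question. The
multiple vanishes for `r = 0` unless `β = 0`, hence the separate case. -/
theorem unitSummable_ballCoeff [NeZero d] (hc : UnitSummable c) (β : Fin d → ℕ)
    (hβ : ∃ j, β j = 0) : UnitSummable (ballCoeff c β) := by
  intro r h0 h1
  rcases h0.eq_or_lt with rfl | hr
  · refine summable_of_ne_finset_zero (s := {0}) fun n hn => ?_
    rw [zero_pow (by simpa using hn), mul_zero]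
  have hd : (0 : ℝ) < d := by exact_mod_cast Nat.pos_of_ne_zero (NeZero.ne d)
  set y : ℝ := r ^ ((d : ℝ)⁻¹)
  have hy : 0 < y := Real.rpow_pos_of_pos hr _
  have hyd : y ^ d = r := Real.rpow_inv_natCast_pow hr.le (NeZero.ne d)
  have hy1 : y < 1 := Real.rpow_lt_one hr.le h1 (inv_pos.mpr hd)
  have h := (hasSum_multinomial_fibers hc (x := fun _ => ((y / d : ℝ) : ℂ)) (by
    simp only [Complex.norm_real, Real.norm_of_nonneg (div_pos hy hd).le, sum_const, card_univ,
      Fintype.card_fin, nsmul_eq_mul]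
    rwa [mul_div_cancel₀ _ hd.ne'])).summable
  have h2 := (h.comp_injective (Prod.mk_right_injective (⟨β, hβ⟩ : {β : Fin d → ℕ // ∃ j, β j = 0}))).norm
  have hp : 0 < ∏ i, (y / d) ^ β i := by positivity
  refine (h2.mul_left (∏ i, (y / d) ^ β i)⁻¹).congr fun n => ?_
  have e : ((d : ℂ) ^ d * ∏ _i : Fin d, ((y / d : ℝ) : ℂ)) = (r : ℝ) := by
    rw [← hyd, prod_const, card_univ, Fintype.card_fin, ← mul_pow]
    push_cast
    rw [mul_div_cancel₀ _ (by exact_mod_cast NeZero.ne d)]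
  simp only [Function.comp_apply]
  have e' : ‖∏ i, ((y / d : ℝ) : ℂ) ^ β i‖ = ∏ i, (y / d) ^ β i := by
    simp only [norm_prod, norm_pow, Complex.norm_real, Real.norm_of_nonneg (div_pos hy hd).le]
  rw [e, norm_mul, norm_mul, norm_pow, Complex.norm_real, Complex.norm_real,
    Real.norm_of_nonneg hr.le, e', inv_mul_cancel_left₀ hp.ne', Real.norm_eq_abs]

theorem sum_norm_mul_lt_one (z w : OpenUnitBall (EuclideanSpace ℂ (Fin d))) :
    ∑ i, ‖(z : EuclideanSpace ℂ (Fin d)) i * star ((w : EuclideanSpace ℂ (Fin d)) i)‖ < 1 := by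
  have hz : ‖(z : EuclideanSpace ℂ (Fin d))‖ < 1 := mem_ball_zero_iff.mp z.2
  have hw : ‖(w : EuclideanSpace ℂ (Fin d))‖ < 1 := mem_ball_zero_iff.mp w.2
  have h1 : ∀ i, ‖(z : EuclideanSpace ℂ (Fin d)) i * star ((w : EuclideanSpace ℂ (Fin d)) i)‖ ≤
      (‖(z : EuclideanSpace ℂ (Fin d)) i‖ ^ 2 + ‖(w : EuclideanSpace ℂ (Fin d)) i‖ ^ 2) / 2 := by
    intro i
    rw [norm_mul, norm_star]
    nlinarith [sq_nonneg (‖(z : EuclideanSpace ℂ (Fin d)) i‖ - ‖(w : EuclideanSpace ℂ (Fin d)) i‖)]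
  refine (Finset.sum_le_sum fun i _ => h1 i).trans_lt ?_
  rw [← Finset.sum_div, Finset.sum_add_distrib, ← EuclideanSpace.norm_sq_eq,
    ← EuclideanSpace.norm_sq_eq]
  nlinarith [norm_nonneg (z : EuclideanSpace ℂ (Fin d)), norm_nonneg (w : EuclideanSpace ℂ (Fin d))]

theorem pairing_ball (z w : OpenUnitBall (EuclideanSpace ℂ (Fin d))) :
    pairing z w =
      ∑ i, (z : EuclideanSpace ℂ (Fin d)) i * star ((w : EuclideanSpace ℂ (Fin d)) i) := by
  simp [pairing, PiLp.inner_apply]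

theorem pairing_tau [NeZero d] (z w : OpenUnitBall (EuclideanSpace ℂ (Fin d))) :
    pairing (tau d z) (tau d w) = (d : ℂ) ^ d *
      ∏ i, (z : EuclideanSpace ℂ (Fin d)) i * star ((w : EuclideanSpace ℂ (Fin d)) i) := by
  have h : ((((d : ℝ) ^ ((d : ℝ) / 2) : ℝ) : ℂ)) * (((d : ℝ) ^ ((d : ℝ) / 2) : ℝ) : ℂ) =
      (d : ℂ) ^ d := by
    have hd : (0 : ℝ) < d := by exact_mod_cast Nat.pos_of_ne_zero (NeZero.ne d)
    rw [← Complex.ofReal_mul, ← Real.rpow_add hd, add_halves, Real.rpow_natCast]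
    push_cast
    rfl
  rw [pairing_disc, Finset.prod_mul_distrib, ← h]
  simp only [tau, star_mul', star_prod, RCLike.star_def, Complex.conj_ofReal]
  ring

/-- The decomposition of the space on the ball into the pieces `z ^ β` times functions of `τ`. The
normalization in `ballCoeff` matches `⟨τ z, τ w⟩ = d ^ d ∏ z_i star w_i`. -/
theorem hasSum_psKernel_tau [NeZero d] (hc : UnitSummable c)
    (z w : OpenUnitBall (EuclideanSpace ℂ (Fin d))) :
    HasSum (fun β : {β : Fin d → ℕ // ∃ j, β j = 0} =>
      (∏ i, (z : EuclideanSpace ℂ (Fin d)) i ^ β.1 i) *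
        star (∏ i, (w : EuclideanSpace ℂ (Fin d)) i ^ β.1 i) *
        psKernel ℂ (ballCoeff c β.1) (tau d z) (tau d w))
      (psKernel (EuclideanSpace ℂ (Fin d)) c z w) := by
  have h := hasSum_multinomial_fibers hc (sum_norm_mul_lt_one z w)
  rw [← pairing_ball, ← pairing_tau] at h
  have e : ∀ β : Fin d → ℕ, (∏ i, (z : EuclideanSpace ℂ (Fin d)) i ^ β i) *
      star (∏ i, (w : EuclideanSpace ℂ (Fin d)) i ^ β i) =
      ∏ i, ((z : EuclideanSpace ℂ (Fin d)) i * star ((w : EuclideanSpace ℂ (Fin d)) i)) ^ β i := by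
    intro β
    simp only [star_prod, star_pow, ← Finset.prod_mul_distrib, mul_pow]
  simp only [e]
  exact h.prod_fiberwise fun β => ((unitSummable_ballCoeff hc β.1 β.2).hasSum
    (norm_pairing_lt_one (tau d z) (tau d w))).mul_left
      (∏ i, ((z : EuclideanSpace ℂ (Fin d)) i * star ((w : EuclideanSpace ℂ (Fin d)) i)) ^ β.1 i)

/-- Composition with `τ` maps multipliers of the space on the disc to multipliers of the space on
the ball. -/
theorem IsKernelMultiplier.comp_tau [NeZero d] {ι : Type*} [Fintype ι] [DecidableEq ι]
    {Φ : OpenUnitBall ℂ → Matrix ι ι ℂ} {C M : ℝ} {a : ℕ → ℝ} (ha : UnitSummable a)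
    (hc : UnitSummable c) (ha0 : ∀ n, 0 < a n) (hc0 : ∀ n, 0 < c n) (hM : 0 ≤ M) (hC : 0 ≤ C)
    (hac : ∀ β : Fin d → ℕ, (∃ j, β j = 0) → ∀ m n, m ≤ n →
      ballCoeff c β m / a m ≤ M * (ballCoeff c β n / a n))
    (hΦ : ContinuousAt Φ discZero) (h : IsKernelMultiplier (psKernel ℂ a) Φ C) :
    IsKernelMultiplier (psKernel (EuclideanSpace ℂ (Fin d)) c) (fun z => Φ (tau d z)) (M * C) := by
  refine IsKernelMultiplier.of_hasSum (fun β => ?_) (hasSum_psKernel_tau hc)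
  have h1 : IsKernelMultiplier (fun z w => psKernel ℂ (ballCoeff c β.1) (tau d z) (tau d w))
      (fun z => Φ (tau d z)) (M * C) :=
    (h.of_almost_monotone ha (unitSummable_ballCoeff hc β.1 β.2) ha0 (fun n =>
      (ballCoeff_pos (Nat.pos_of_ne_zero (NeZero.ne d)) hc0 β.1 n).le) hM hC (hac β.1 β.2)
      hΦ).pullback (tau d)
  exact h1.mul_posKernel (Matrix.posSemidef_mul_star
    fun z : OpenUnitBall (EuclideanSpace ℂ (Fin d)) =>
      ∏ i, (z : EuclideanSpace ℂ (Fin d)) i ^ β.1 i)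

end MonomialExpansion

/-! ### Averaging over rotations that leave `τ` invariant -/

section Averaging

open Finset Filter Topology

variable {d : ℕ} [NeZero d] {c : ℕ → ℝ}

/-- Diagonal points `(t, …, t)` suffice: their norm is `√d ‖t‖`, and `τ` takes the value `(√d t) ^
d` there. -/
theorem tau_surjective : Function.Surjective (tau d) := by
  intro ζ
  have hζ : ‖(ζ : ℂ)‖ < 1 := mem_ball_zero_iff.mp ζ.2
  have hd0 : 0 < d := Nat.pos_of_ne_zero (NeZero.ne d)
  have hd : (0 : ℝ) < d := by exact_mod_cast hd0
  set D : ℝ := (d : ℝ) ^ ((d : ℝ) / 2)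
  have hD : 0 < D := by positivity
  have hDs : D = √d ^ d := by
    change (d : ℝ) ^ ((d : ℝ) / 2) = _
    rw [Real.sqrt_eq_rpow, ← Real.rpow_natCast, ← Real.rpow_mul hd.le]
    congr 1
    ring
  obtain ⟨t, ht⟩ := IsAlgClosed.exists_pow_nat_eq ((ζ : ℂ) / (D : ℂ)) hd0
  have hD' : (D : ℂ) ≠ 0 := by exact_mod_cast hD.ne'
  have hDt : (D : ℂ) * t ^ d = ζ := by rw [ht, mul_div_cancel₀ _ hD']
  have hn : (√d * ‖t‖) ^ d < 1 := by
    rw [mul_pow, ← hDs]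
    have := congrArg norm hDt
    rw [norm_mul, norm_pow, Complex.norm_real, Real.norm_of_nonneg hD.le] at this
    rwa [this]
  have hn' : √d * ‖t‖ < 1 := (pow_lt_one_iff_of_nonneg (by positivity) hd0.ne').mp hn
  have hb : ‖(WithLp.toLp 2 fun _ => t : EuclideanSpace ℂ (Fin d))‖ < 1 := by
    rw [EuclideanSpace.norm_eq]
    simp only [sum_const, card_univ, Fintype.card_fin, nsmul_eq_mul]
    rwa [Real.sqrt_mul hd.le, Real.sqrt_sq (norm_nonneg t)]
  refine ⟨⟨WithLp.toLp 2 fun _ => t, mem_ball_zero_iff.mpr hb⟩, Subtype.ext ?_⟩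
  simpa [tau] using hDt

/-- The coordinatewise rotations by roots of unity with product one. -/
noncomputable def rotationChar (d : ℕ) [NeZero d] (N : ℕ) [NeZero N] (j : Fin d) :
    AddChar (Fin d → ZMod N) ℂ :=
  ZMod.stdAddChar.compAddMonoidHom (Pi.evalAddMonoidHom _ j) *
    if j = 0 then (ZMod.stdAddChar.compAddMonoidHom (∑ i, Pi.evalAddMonoidHom (fun _ => ZMod N) i))⁻¹
    else 1

/-- The correction at coordinate `0` is the inverse of the product of all the coordinate characters.
-/
theorem prod_rotationChar (N : ℕ) [NeZero N] : ∏ j, rotationChar d N j = 1 := by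
  have h : ∏ j : Fin d, ZMod.stdAddChar.compAddMonoidHom (Pi.evalAddMonoidHom (fun _ => ZMod N) j) =
      ZMod.stdAddChar.compAddMonoidHom (∑ i : Fin d, Pi.evalAddMonoidHom (fun _ => ZMod N) i) := by
    ext θ
    rw [AddChar.prod_apply, AddChar.compAddMonoidHom_apply, AddMonoidHom.finsetSum_apply]
    simp only [AddChar.compAddMonoidHom_apply, Pi.evalAddMonoidHom_apply]
    exact (map_sum (ZMod.stdAddChar (N := N)).toAddMonoidHom θ univ).symm
  simp only [rotationChar, Finset.prod_mul_distrib]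
  rw [Finset.prod_ite_eq' univ (0 : Fin d), if_pos (mem_univ _), h, mul_inv_cancel]

theorem norm_rotationChar (N : ℕ) [NeZero N] (j : Fin d) (θ : Fin d → ZMod N) :
    ‖rotationChar d N j θ‖ = 1 := AddChar.norm_apply _ _

/-- The rotation of the ball given by `rotationChar`. -/
noncomputable def ballRotation (N : ℕ) [NeZero N] (θ : Fin d → ZMod N)
    (z : OpenUnitBall (EuclideanSpace ℂ (Fin d))) : OpenUnitBall (EuclideanSpace ℂ (Fin d)) :=
  ⟨WithLp.toLp 2 fun j => rotationChar d N j θ * (z : EuclideanSpace ℂ (Fin d)) j, by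
    have hz : ‖(z : EuclideanSpace ℂ (Fin d))‖ < 1 := mem_ball_zero_iff.mp z.2
    rw [mem_ball_zero_iff, EuclideanSpace.norm_eq]
    simpa only [norm_mul, norm_rotationChar, one_mul, ← EuclideanSpace.norm_eq] using hz⟩

theorem ballRotation_apply (N : ℕ) [NeZero N] (θ : Fin d → ZMod N)
    (z : OpenUnitBall (EuclideanSpace ℂ (Fin d))) (j : Fin d) :
    (ballRotation N θ z : EuclideanSpace ℂ (Fin d)) j =
      rotationChar d N j θ * (z : EuclideanSpace ℂ (Fin d)) j := rfl

theorem tau_ballRotation (N : ℕ) [NeZero N] (θ : Fin d → ZMod N)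
    (z : OpenUnitBall (EuclideanSpace ℂ (Fin d))) : tau d (ballRotation N θ z) = tau d z := by
  have h : ∏ j, rotationChar d N j θ = 1 := by
    rw [← AddChar.prod_apply, prod_rotationChar, AddChar.one_apply]
  refine Subtype.ext ?_
  simp only [tau, ballRotation_apply, Finset.prod_mul_distrib, h, one_mul]

/-- Here `0` is the trivial character. Evaluation at the `j`-th unit vector gives the standard
character at `α j - α 0`, so triviality forces a congruence modulo `N`; the bound on `α` makes it an
equality. -/
theorem prod_rotationChar_pow_eq_zero_iff {N : ℕ} [NeZero N] {α : Fin d → ℕ} (hα : ∀ i, α i < N) :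
    ∏ j, rotationChar d N j ^ α j = 0 ↔ ∀ j, α j = α 0 := by
  constructor
  · intro h j
    rcases eq_or_ne j 0 with rfl | hj
    · rfl
    have h1 := AddChar.eq_zero_iff.mp h (Pi.single j 1)
    have h2 : ∀ i, rotationChar d N i (Pi.single j 1) ^ α i =
        (if i = j then ZMod.stdAddChar (α j : ZMod N) else 1) *
          if i = 0 then ZMod.stdAddChar (-(α 0 : ZMod N)) else 1 := by
      intro i
      rw [rotationChar, AddChar.mul_apply, mul_pow]
      congr 1
      · rcases eq_or_ne i j with rfl | hi
        · simp [← AddChar.map_nsmul_eq_pow]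
        · simp [hi]
      · rcases eq_or_ne i 0 with rfl | hi
        · simp [← AddChar.map_nsmul_eq_pow]
        · simp [hi]
    rw [AddChar.prod_apply] at h1
    simp only [AddChar.pow_apply, h2, Finset.prod_mul_distrib, Finset.prod_ite_eq',
      mem_univ, if_true] at h1
    rw [← AddChar.map_add_eq_mul, ← AddChar.map_zero_eq_one (ZMod.stdAddChar (N := N))] at h1
    have h3 := ZMod.injective_stdAddChar h1
    rw [← sub_eq_add_neg, sub_eq_zero, ZMod.natCast_eq_natCast_iff'] at h3
    rwa [Nat.mod_eq_of_lt (hα j), Nat.mod_eq_of_lt (hα 0)] at h3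
  · intro h
    simp only [h, Finset.prod_pow, prod_rotationChar, one_pow]
    rfl

/-- The average of the kernel over rotations in both variables. -/
noncomputable def averagedKernel (c : ℕ → ℝ) (N : ℕ) [NeZero N]
    (z w : OpenUnitBall (EuclideanSpace ℂ (Fin d))) : ℂ :=
  ∑ θ : Fin d → ZMod N, ∑ η : Fin d → ZMod N,
    (Fintype.card (Fin d → ZMod N) : ℂ)⁻¹ * star ((Fintype.card (Fin d → ZMod N) : ℂ)⁻¹) *
      psKernel (EuclideanSpace ℂ (Fin d)) c (ballRotation N θ z) (ballRotation N η w)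

/-- Averaging is a congruence, and `Φ ∘ τ` is invariant under the rotations, so only the kernel is
averaged. -/
theorem IsKernelMultiplier.averaged {ι : Type*} [Fintype ι] [DecidableEq ι]
    {Φ : OpenUnitBall ℂ → Matrix ι ι ℂ} {C : ℝ}
    (h : IsKernelMultiplier (psKernel (EuclideanSpace ℂ (Fin d)) c) (fun z => Φ (tau d z)) C)
    (N : ℕ) [NeZero N] : IsKernelMultiplier (averagedKernel c N) (fun z => Φ (tau d z)) C := by
  have h1 := Matrix.PosSemidef.congruence h
    (fun _ : Fin d → ZMod N => (Fintype.card (Fin d → ZMod N) : ℂ)⁻¹)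
    (fun θ (x : OpenUnitBall (EuclideanSpace ℂ (Fin d)) × ι) => (ballRotation N θ x.1, x.2))
  refine (congrArg Matrix.PosSemidef (Matrix.ext fun x y => ?_)).mpr h1
  simp only [multiplierKernel_apply, Matrix.of_apply, tau_ballRotation, averagedKernel, Finset.sum_mul,
    mul_assoc]

open Classical in
-- Rotation multiplies the monomial of index `α` by a character in each variable; the mean of a
-- character is `1` or `0` according to whether it is trivial.
theorem hasSum_averagedKernel (hc : UnitSummable c) (N : ℕ) [NeZero N]
    (z w : OpenUnitBall (EuclideanSpace ℂ (Fin d))) :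
    HasSum (fun α : Fin d → ℕ => if ∏ j, rotationChar d N j ^ α j = 0 then
      (c (∑ i, α i) : ℂ) * (Nat.multinomial univ α * ∏ i, ((z : EuclideanSpace ℂ (Fin d)) i *
        star ((w : EuclideanSpace ℂ (Fin d)) i)) ^ α i) else 0) (averagedKernel c N z w) := by
  set r : ℂ := (Fintype.card (Fin d → ZMod N) : ℂ)⁻¹ with hr
  have hcard : (Fintype.card (Fin d → ZMod N) : ℂ) ≠ 0 := by exact_mod_cast Fintype.card_ne_zero
  have h1 : ∀ θ η : Fin d → ZMod N, HasSum (fun α : Fin d → ℕ => r * star r *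
      ((c (∑ i, α i) : ℂ) * (Nat.multinomial univ α *
        ∏ i, ((ballRotation N θ z : EuclideanSpace ℂ (Fin d)) i *
          star ((ballRotation N η w : EuclideanSpace ℂ (Fin d)) i)) ^ α i)))
      (r * star r * psKernel (EuclideanSpace ℂ (Fin d)) c (ballRotation N θ z) (ballRotation N η w)) := by
    intro θ η
    have h := hasSum_multinomial hc (sum_norm_mul_lt_one (ballRotation N θ z) (ballRotation N η w))
    rw [← pairing_ball] at h
    exact h.mul_left _
  have h2 := hasSum_sum fun θ (_ : θ ∈ (univ : Finset (Fin d → ZMod N))) =>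
    hasSum_sum fun η (_ : η ∈ (univ : Finset (Fin d → ZMod N))) => h1 θ η
  refine h2.congr_fun fun α => ?_
  set χ := ∏ j, rotationChar d N j ^ α j with hχ
  have h3 : ∀ θ, ∏ j, rotationChar d N j θ ^ α j = χ θ := fun θ => by
    rw [hχ, AddChar.prod_apply]
    rfl
  have h4 : r * ∑ θ, χ θ = if χ = 0 then 1 else 0 := by
    rw [AddChar.sum_eq_ite]
    split_ifs
    · rw [hr, inv_mul_cancel₀ hcard]
    · rw [mul_zero]
  have h5 : ∀ θ η : Fin d → ZMod N, r * star r * ((c (∑ i, α i) : ℂ) * (Nat.multinomial univ α *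
        ∏ i, ((ballRotation N θ z : EuclideanSpace ℂ (Fin d)) i *
          star ((ballRotation N η w : EuclideanSpace ℂ (Fin d)) i)) ^ α i)) =
      ((c (∑ i, α i) : ℂ) * (Nat.multinomial univ α * ∏ i, ((z : EuclideanSpace ℂ (Fin d)) i *
        star ((w : EuclideanSpace ℂ (Fin d)) i)) ^ α i)) * ((r * χ θ) * star (r * χ η)) := by
    intro θ η
    rw [← h3, ← h3]
    simp only [ballRotation_apply, star_mul', star_prod, star_pow, mul_pow, Finset.prod_mul_distrib]
    ring
  simp only [h5, ← Finset.mul_sum, ← Finset.sum_mul, ← star_sum, h4]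
  split_ifs <;> simp

theorem hasSum_psKernel_ballCoeff_zero (hc : UnitSummable c)
    (z w : OpenUnitBall (EuclideanSpace ℂ (Fin d))) :
    HasSum (fun α : Fin d → ℕ => if ∀ j, α j = α 0 then
      (c (∑ i, α i) : ℂ) * (Nat.multinomial univ α * ∏ i, ((z : EuclideanSpace ℂ (Fin d)) i *
        star ((w : EuclideanSpace ℂ (Fin d)) i)) ^ α i) else 0)
      (psKernel ℂ (ballCoeff c (0 : Fin d → ℕ)) (tau d z) (tau d w)) := by
  have h := (unitSummable_ballCoeff hc (0 : Fin d → ℕ) ⟨0, rfl⟩).hasSum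
    (norm_pairing_lt_one (tau d z) (tau d w))
  have hinj : Function.Injective fun (n : ℕ) (_ : Fin d) => n := fun m n h => congrFun h 0
  refine (hinj.hasSum_iff (fun α hα => if_neg fun h => hα ⟨α 0, funext fun j => (h j).symm⟩)).mp ?_
  refine h.congr_fun fun n => ?_
  have e := multinomial_term_eq (c := c) (0 : Fin d → ℕ) n fun i =>
    (z : EuclideanSpace ℂ (Fin d)) i * star ((w : EuclideanSpace ℂ (Fin d)) i)
  simp only [Pi.zero_apply, zero_add, pow_zero, Finset.prod_const_one, one_mul] at e
  rw [pairing_tau, ← e, Function.comp_apply, if_pos fun _ => rfl]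

/-- A fixed `N` detects equality of the entries of `α` only modulo `N`. Each `α` is decided
correctly once `N ≥ |α|`, and dominated convergence gives the limit. -/
theorem tendsto_averagedKernel (hc : UnitSummable c)
    (z w : OpenUnitBall (EuclideanSpace ℂ (Fin d))) :
    Tendsto (fun N : ℕ => averagedKernel c (N + 1) z w) atTop
      (𝓝 (psKernel ℂ (ballCoeff c (0 : Fin d → ℕ)) (tau d z) (tau d w))) := by
  classical
  have h0 := (hasSum_multinomial hc (sum_norm_mul_lt_one z w)).summable.norm
  rw [← (hasSum_psKernel_ballCoeff_zero hc z w).tsum_eq]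
  simp only [← (hasSum_averagedKernel hc _ z w).tsum_eq]
  refine tendsto_tsum_of_dominated_convergence h0 (fun α => ?_)
    (Eventually.of_forall fun N α => ?_)
  · refine tendsto_const_nhds.congr' ?_
    filter_upwards [eventually_ge_atTop (∑ i, α i)] with N hN
    have hα : ∀ i, α i < N + 1 := fun i => Nat.lt_succ_of_le
      ((Finset.single_le_sum (fun _ _ => Nat.zero_le _) (mem_univ i)).trans hN)
    simp only [prod_rotationChar_pow_eq_zero_iff hα]
  · split_ifs
    · exact le_rfl
    · rw [norm_zero]
      exact norm_nonneg _

/-- If `Φ ∘ τ` is a multiplier of the space on the ball, then `Φ` is a multiplier of the space on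
the disc. -/
theorem IsKernelMultiplier.of_comp_tau {ι : Type*} [Fintype ι] [DecidableEq ι]
    {Φ : OpenUnitBall ℂ → Matrix ι ι ℂ} {C : ℝ} (hc : UnitSummable c)
    (h : IsKernelMultiplier (psKernel (EuclideanSpace ℂ (Fin d)) c) (fun z => Φ (tau d z)) C) :
    IsKernelMultiplier (psKernel ℂ (ballCoeff c (0 : Fin d → ℕ))) Φ C :=
  IsKernelMultiplier.of_pullback tau_surjective <|
    IsKernelMultiplier.of_tendsto (l := atTop) (L := fun N : ℕ => averagedKernel c (N + 1))
      (Eventually.of_forall fun N => h.averaged (N + 1)) fun z w => tendsto_averagedKernel hc z w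

end Averaging

/-! ### Composition with `τ` on multiplier algebras -/

section CompTau

open Filter Topology

/-! ### Continuity of multipliers at the origin -/

section Continuity

variable {H : Type*} [NormedAddCommGroup H] [InnerProductSpace ℂ H] [RKHS ℂ H (OpenUnitBall ℂ) ℂ]
  [CompleteSpace H] {a : ℕ → ℝ}

/-- `f z - f 0` is the inner product of `f` with a difference of kernel functions, whose squared
norm `K(z, z) - a 0` tends to `0`. -/
theorem continuousAt_apply_discZero (ha : UnitSummable a)
    (hK : ∀ x y, RKHS.kernel H x y = psKernel ℂ a x y • ContinuousLinearMap.id ℂ ℂ) (f : H) :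
    ContinuousAt f discZero := by
  have hk : ∀ x y, inner ℂ (RKHS.kerFun H x (1 : ℂ)) (RKHS.kerFun H y (1 : ℂ)) =
      psKernel ℂ a x y := fun x y => by
    rw [RKHS.kerFun_inner, RKHS.kerFun_apply, hK]
    simp
  have h1 : ∀ z, ‖RKHS.kerFun H z (1 : ℂ) - RKHS.kerFun H discZero (1 : ℂ)‖ ^ 2 =
      (psKernel ℂ a z z - a 0).re := fun z => by
    rw [← Complex.ofReal_re (‖_‖ ^ 2), ofReal_norm_sq_eq_inner]
    simp only [inner_sub_left, inner_sub_right, hk, psKernel_discZero_left ha,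
      psKernel_discZero_right ha]
    ring_nf
  have h2 : Tendsto (fun z => psKernel ℂ a z z) (𝓝 discZero) (𝓝 (a 0)) := by
    have c : Continuous fun z : OpenUnitBall ℂ => pairing z z := by
      simp only [pairing_disc]
      fun_prop
    have := (continuousAt_psFun ha (norm_pairing_lt_one discZero discZero)).tendsto.comp
      (c.tendsto discZero)
    change Tendsto _ _ (𝓝 (psKernel ℂ a discZero discZero)) at this
    rwa [psKernel_discZero_left ha] at this
  have h3 : Tendsto (fun z => ‖RKHS.kerFun H z (1 : ℂ) - RKHS.kerFun H discZero (1 : ℂ)‖)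
      (𝓝 discZero) (𝓝 0) := by
    have h := (Real.continuous_sqrt.tendsto _).comp
      ((Complex.continuous_re.tendsto _).comp (h2.sub_const (a 0 : ℂ)))
    simp only [sub_self, Complex.zero_re, Real.sqrt_zero] at h
    refine h.congr fun z => ?_
    simp only [Function.comp_apply]
    rw [← h1, Real.sqrt_sq (norm_nonneg _)]
  rw [ContinuousAt, tendsto_iff_norm_sub_tendsto_zero]
  have h4 := h3.mul_const ‖f‖
  rw [zero_mul] at h4
  refine squeeze_zero (fun z => norm_nonneg _) (fun z => ?_) h4
  have h5 : f z - f discZero =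
      inner ℂ (RKHS.kerFun H z (1 : ℂ) - RKHS.kerFun H discZero (1 : ℂ)) f := by
    rw [inner_sub_left, RKHS.kerFun_inner, RKHS.kerFun_inner]
    simp
  rw [h5]
  exact norm_inner_le_norm _ _

/-- The kernel function at the origin is the constant `a 0`, so `φ` is a multiple of an element of
the space. -/
theorem continuousAt_mult_discZero (ha : UnitSummable a) (ha0 : 0 < a 0)
    (hK : ∀ x y, RKHS.kernel H x y = psKernel ℂ a x y • ContinuousLinearMap.id ℂ ℂ) (φ : Mult H) :
    ContinuousAt φ.1 discZero := by
  have h := continuousAt_apply_discZero ha hK (multOperator φ (RKHS.kerFun H discZero (1 : ℂ)))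
  have e : ∀ z, φ.1 z = multOperator φ (RKHS.kerFun H discZero (1 : ℂ)) z * (a 0 : ℂ)⁻¹ := by
    intro z
    have : (a 0 : ℂ) ≠ 0 := by exact_mod_cast ha0.ne'
    rw [multOperator_apply, RKHS.kerFun_apply, hK, psKernel_discZero_right ha]
    simp [this]
  rw [funext e]
  exact h.mul_const _

end Continuity

variable {d : ℕ} [NeZero d] {H₁ H₂ : Type*} [NormedAddCommGroup H₁] [InnerProductSpace ℂ H₁]
  [CompleteSpace H₁] [RKHS ℂ H₁ (OpenUnitBall ℂ) ℂ] [NormedAddCommGroup H₂]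
  [InnerProductSpace ℂ H₂] [CompleteSpace H₂]
  [RKHS ℂ H₂ (OpenUnitBall (EuclideanSpace ℂ (Fin d))) ℂ]

/-- Composition with `τ` as a homomorphism of multiplier algebras. -/
noncomputable def multCompTau (h : ∀ φ : Mult H₁, (φ.1 ∘ tau d) ∈ Mult H₂) : Mult H₁ →ₐ[ℂ] Mult H₂ where
  toFun φ := ⟨φ.1 ∘ tau d, h φ⟩
  map_one' := rfl
  map_mul' _ _ := rfl
  map_zero' := rfl
  map_add' _ _ := rfl
  commutes' _ := rfl

theorem kernel_eq_psKernel {E H : Type*} [NormedAddCommGroup E] [InnerProductSpace ℂ E]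
    [NormedAddCommGroup H] [InnerProductSpace ℂ H] [CompleteSpace H] [RKHS ℂ H (OpenUnitBall E) ℂ]
    {g : ℂ → ℂ} {a : ℕ → ℝ} (hK : RKHS.kernel H = ballKernel E g)
    (ha : ∀ x : ℂ, ‖x‖ < 1 → HasSum (fun n => (a n : ℂ) * x ^ n) (g x)) (x y : OpenUnitBall E) :
    RKHS.kernel H x y = psKernel E a x y • ContinuousLinearMap.id ℂ ℂ := by
  rw [hK, ballKernel, Matrix.of_apply, psKernel, psFun, (ha _ (norm_pairing_lt_one x y)).tsum_eq]

/-- Only positivity and the order of magnitude of the coefficients matter, so both scales of spaces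
are covered at once. -/
theorem exists_completelyBoundedIso_comp_tau {g₁ g₂ : ℂ → ℂ} {a c : ℕ → ℝ} {s : ℝ}
    (hK₁ : RKHS.kernel H₁ = ballKernel ℂ g₁)
    (hK₂ : RKHS.kernel H₂ = ballKernel (EuclideanSpace ℂ (Fin d)) g₂)
    (ha : ∀ x : ℂ, ‖x‖ < 1 → HasSum (fun n => (a n : ℂ) * x ^ n) (g₁ x))
    (hc : ∀ x : ℂ, ‖x‖ < 1 → HasSum (fun n => (c n : ℂ) * x ^ n) (g₂ x))
    (ha0 : ∀ n, 0 < a n) (hc0 : ∀ n, 0 < c n)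
    (has : IsComparable a fun n => ((n : ℝ) + 1) ^ (s - ((d : ℝ) - 1) / 2))
    (hcs : IsComparable c fun n => ((n : ℝ) + 1) ^ s) :
    ∃ π : Mult H₁ →ₐ[ℂ] Mult H₂,
      (∀ φ : Mult H₁, (π φ : OpenUnitBall (EuclideanSpace ℂ (Fin d)) → ℂ) =
        (φ : OpenUnitBall ℂ → ℂ) ∘ tau d) ∧
      IsCompletelyBoundedIsoOntoImage (multRep H₁) (multRep H₂) π := by
  have hd : 0 < d := Nat.pos_of_ne_zero (NeZero.ne d)
  have hk₁ := kernel_eq_psKernel hK₁ ha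
  have hk₂ := kernel_eq_psKernel hK₂ hc
  have hau := UnitSummable.of_hasSum ha
  have hcu := UnitSummable.of_hasSum hc
  obtain ⟨M₀, hM₀, hM⟩ := exists_ballCoeff_almost_monotone hd hcs has ha0
  obtain ⟨m₁, M₁, hm₁, hM₁, hb⟩ := isComparable_ballCoeff_zero hd hcs has ha0
  have key : ∀ (n : ℕ) (M : Matrix (Fin n) (Fin n) (Mult H₁)),
      IsKernelMultiplier (psKernel (EuclideanSpace ℂ (Fin d)) c)
        (fun z => M.map fun φ => φ.1 (tau d z))
        (M₀ * ‖matrixOperator (M.map (multRep H₁))‖ ^ 2) := by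
    intro n M
    have hΦ : ContinuousAt (fun x => M.map fun φ => φ.1 x) discZero :=
      continuousAt_pi.mpr fun i => continuousAt_pi.mpr fun j =>
        continuousAt_mult_discZero hau (ha0 0) hk₁ (M i j)
    exact IsKernelMultiplier.comp_tau (Φ := fun x => M.map fun φ => φ.1 x) hau hcu ha0 hc0 hM₀.le
      (sq_nonneg _) hM hΦ (isKernelMultiplier_of_norm_le hk₁ M le_rfl)
  -- The kernel bound for `1 × 1` matrices already shows that the map is well defined.
  have hmem : ∀ φ : Mult H₁, (φ.1 ∘ tau d) ∈ Mult H₂ := fun φ =>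
    mem_mult_of_isKernelMultiplier hk₂ (key 1 (Matrix.of fun _ _ => φ))
  refine ⟨multCompTau hmem, fun φ => rfl, ⟨√M₀, fun n M => ?_⟩, ?_, ?_⟩
  · have h := norm_matrixOperator_le_of_isKernelMultiplier hk₂ (M.map (multCompTau hmem))
      (key n M)
    rwa [Real.sqrt_mul hM₀.le, Real.sqrt_sq (norm_nonneg _)] at h
  · intro φ ψ h
    refine Subtype.ext (funext fun x => ?_)
    obtain ⟨z, rfl⟩ := tau_surjective (d := d) x
    exact congrFun (congrArg Subtype.val h) z
  -- Averaging yields a multiplier for the coefficients `ballCoeff c 0`; returning to `a` inverts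
  -- the comparison, so the constants become `M₁⁻¹` and `m₁⁻¹`.
  · refine ⟨√(m₁⁻¹ / M₁⁻¹), fun n M => ?_⟩
    set e := AlgEquiv.ofInjective (multCompTau hmem) _
    set N : Matrix (Fin n) (Fin n) (Mult H₁) := M.map e.symm
    set M' : Matrix (Fin n) (Fin n) (Mult H₂) := M.map (multCompTau hmem).range.val
    have hN : ∀ i j, M' i j = multCompTau hmem (N i j) := fun i j => by
      have := e.apply_symm_apply (M i j)
      exact (congrArg Subtype.val this).symm
    have h1 := isKernelMultiplier_of_norm_le hk₂ M' le_rfl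
    have h2 : (fun z => M'.map fun φ => φ.1 z) = fun z => N.map fun φ => φ.1 (tau d z) := by
      funext z
      ext i j
      rw [Matrix.map_apply, hN]
      rfl
    rw [h2] at h1
    have h3 := (IsKernelMultiplier.of_comp_tau (Φ := fun x => N.map fun φ => φ.1 x) hcu
      h1).of_coeff_equivalent (unitSummable_ballCoeff hcu _ ⟨0, rfl⟩) hau (inv_pos.mpr hM₁)
      (inv_pos.mpr hm₁).le (sq_nonneg _)
      (fun n => by rw [inv_mul_le_iff₀ hM₁]; exact (hb n).2)
      (fun n => by rw [← div_eq_inv_mul, le_div_iff₀' hm₁]; exact (hb n).1)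
    have h4 := norm_matrixOperator_le_of_isKernelMultiplier hk₁ N h3
    rwa [Real.sqrt_mul (by positivity), Real.sqrt_sq (norm_nonneg _)] at h4

end CompTau

theorem mainTheorem10 (d : ℕ) [NeZero d] :
    (∀ s : ℝ,
      ∃ π : Mult (BesovSpace ℂ (s - ((d : ℝ) - 1) / 2)) →ₐ[ℂ]
          Mult (BesovSpace (EuclideanSpace ℂ (Fin d)) s),
        (∀ φ : Mult (BesovSpace ℂ (s - ((d : ℝ) - 1) / 2)),
          (π φ : OpenUnitBall (EuclideanSpace ℂ (Fin d)) → ℂ) =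
            (φ : OpenUnitBall ℂ → ℂ) ∘ tau d) ∧
        IsCompletelyBoundedIsoOntoImage
          (multRep (BesovSpace ℂ (s - ((d : ℝ) - 1) / 2)))
          (multRep (BesovSpace (EuclideanSpace ℂ (Fin d)) s)) π) ∧
    (∀ (a : ℝ≥0) (ha : ((d : ℝ) - 1) / 2 ≤ a),
      ∃ π : Mult (DirichletSpace ℂ (NNReal.mk (a - ((d : ℝ) - 1) / 2) (sub_nonneg.mpr ha))) →ₐ[ℂ]
          Mult (DirichletSpace (EuclideanSpace ℂ (Fin d)) a),
        (∀ φ : Mult (DirichletSpace ℂ (NNReal.mk (a - ((d : ℝ) - 1) / 2) (sub_nonneg.mpr ha))),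
          (π φ : OpenUnitBall (EuclideanSpace ℂ (Fin d)) → ℂ) =
            (φ : OpenUnitBall ℂ → ℂ) ∘ tau d) ∧
        IsCompletelyBoundedIsoOntoImage
          (multRep (DirichletSpace ℂ (NNReal.mk (a - ((d : ℝ) - 1) / 2) (sub_nonneg.mpr ha))))
          (multRep (DirichletSpace (EuclideanSpace ℂ (Fin d)) a)) π) := by
  refine ⟨fun s => ?_, fun a ha => ?_⟩
  · exact exists_completelyBoundedIso_comp_tau (s := s)
      (a := fun n => (n + 1 : ℝ) ^ (s - ((d : ℝ) - 1) / 2)) (c := fun n => (n + 1 : ℝ) ^ s)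
      (kernel_besovSpace ℂ _) (kernel_besovSpace _ s) (hasSum_besovFun _) (hasSum_besovFun s)
      (fun n => by positivity) (fun n => by positivity) (IsComparable.refl _) (IsComparable.refl _)
  · obtain ⟨b, hb0, hb, hbs⟩ :=
      exists_coeff_dirichletFun (NNReal.mk (a - ((d : ℝ) - 1) / 2) (sub_nonneg.mpr ha))
    obtain ⟨c, hc0, hc, hcs⟩ := exists_coeff_dirichletFun a
    -- The coefficients of `𝒟_a` have order `(n + 1) ^ (a - 1)`, and the shift by `(d - 1) / 2` is
    -- the same in both parameters.
    refine exists_completelyBoundedIso_comp_tau (s := (a : ℝ) - 1)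
      (kernel_dirichletSpace ℂ _) (kernel_dirichletSpace _ a) hb hc hb0 hc0 ?_ hcs
    have e : (a : ℝ) - 1 - ((d : ℝ) - 1) / 2 =
        (NNReal.mk (a - ((d : ℝ) - 1) / 2) (sub_nonneg.mpr ha) : ℝ) - 1 := by
      rw [NNReal.coe_mk]
      ring
    rwa [e]
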